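/- Let $K$ be a perfect field, let $P=K[X_0,\dots,X_n]$ with its standard grading, let $t\ge 1$, let $p_1,\dots,p_t$ be distinct $K$-rational points of $\mathbb{P}^n$, and let $m_1,\dots,m_t$ be positive integers. For each $i$ let $I_{p_i}\subseteq P$ be the homogeneous vanishing ideal of $p_i$, and let $\mathbb{X}=m_1p_1+\cdots+m_tp_t$ be the fat point scheme in $\mathbb{P}^n$ defined by the ideal $I_{\mathbb{X}}=I_{p_1}^{m_1}\cap\cdots\cap I_{p_t}^{m_t}$, with homogeneous coordinate ring $R=P/I_{\mathbb{X}}$. For $m\ge 1$ let $\Omega^m_{R/K}=\Lambda^m_R\,\Omega^1_{R/K}$ be the module of Kähler differential $m$-forms, graded so that $d$ has degree $0$: the component $(\Omega^m_{R/K})_i$ is spanned over $K$ by the forms $f\,dg_1\wedge\cdots\wedge dg_m$ with $f,g_1,\dots,g_m\in R$ homogeneous and $\deg f+\deg g_1+\cdots+\deg g_m=i$. Let $\mathrm{HP}(\Omega^m_{R/K})$ denote its (constant) Hilbert polynomial, i.e. the common value of $\dim_K(\Omega^m_{R/K})_i$ for all $i\gg 0$. Assume that $\mathrm{char}(K)=0$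 or $\mathrm{char}(K)>\max\{m_1,\dots,m_t\}$. Then for every $m\in\{1,\dots,n+1\}$ the number $\mathrm{HP}(\Omega^m_{R/K})$ exists, and $$ \mathrm{HP}(\Omega^m_{R/K})= \begin{cases} \sum\limits_{i=1}^t\Bigl[\binom{n+m_i-1}{n}+(m_i-1)\binom{n+m_i-1}{n-1}\Bigr] & \text{if } m=1,\\[2mm] \sum\limits_{i=1}^t\Bigl[\binom{n+1}{m}\binom{n+m_i-2}{n}+\delta_{i,m}\Bigr] & \text{if } 1<m\le n,\\[2mm] \sum\limits_{i=1}^t\binom{n+m_i-2}{n} & \text{if } m=n+1, \end{cases} $$ where $$ \delta_{i,m}=\binom{m+m_i-2}{m}\binom{n+m_i-2}{n-m-1}+\binom{m+m_i-3}{m-1}\binom{n+m_i-2}{n-m}, $$ and where $\binom{a}{b}=0$ for $b<0$ and $\binom{a}{0}=1$ for all integers $a$. -/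

import Mathlib

open scoped LinearAlgebra.Projectivization

/-- The binomial coefficient `a choose b` for integers `a`, `b`, which is zero for `b < 0`. -/
noncomputable def binom (a b : ℤ) : ℤ := if 0 ≤ b then Ring.choose a b.toNat else 0

namespace FatPoint

variable {K : Type*} [Field K] {n : ℕ}

/-- The homogeneous vanishing ideal in `K[X₀, …, Xₙ]` of a `K`-rational point of projective
`n`-space: it is generated by the homogeneous polynomials which vanish at the point. -/
noncomputable def pointIdeal (p : ℙ K (Fin (n + 1) → K)) : Ideal (MvPolynomial (Fin (n + 1)) K) :=
  Ideal.span {f | (∃ d : ℕ, f.IsHomogeneous d) ∧ MvPolynomial.eval p.rep f = 0}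

/-- The vanishing ideal `I_{p₁}^{m₁} ∩ ⋯ ∩ I_{p_t}^{m_t}` of the fat point scheme
`m₁ p₁ + ⋯ + m_t p_t`. -/
noncomputable def fatPointIdeal {t : ℕ} (p : Fin t → ℙ K (Fin (n + 1) → K)) (mult : Fin t → ℕ) :
    Ideal (MvPolynomial (Fin (n + 1)) K) :=
  ⨅ i, pointIdeal (p i) ^ mult i

/-- The homogeneous coordinate ring `R = K[X₀, …, Xₙ] / I`. -/
abbrev CoordRing (I : Ideal (MvPolynomial (Fin (n + 1)) K)) : Type _ :=
  MvPolynomial (Fin (n + 1)) K ⧸ I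

/-- The module of Kähler differential `m`-forms of `R / K`, the `m`-th exterior power over `R`
of the module of Kähler differentials of `R / K`. -/
abbrev KaehlerForms (I : Ideal (MvPolynomial (Fin (n + 1)) K)) (m : ℕ) : Type _ :=
  ⋀[CoordRing I]^m (Ω[CoordRing I⁄K])

/-- The homogeneous component of degree `i` of the module of Kähler differential `m`-forms of
`R / K`, where `R = K[X₀, …, Xₙ] / I` has the standard grading and `d` has degree zero:
it is the `K`-span of the forms `f dg₁ ∧ ⋯ ∧ dg_m` with `f, g₁, …, g_m` homogeneous and
`deg f + deg g₁ + ⋯ + deg g_m = i`. -/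
noncomputable def homogeneousForms (I : Ideal (MvPolynomial (Fin (n + 1)) K)) (m i : ℕ) :
    Submodule K (KaehlerForms I m) :=
  Submodule.span K {w | ∃ (f : MvPolynomial (Fin (n + 1)) K)
    (g : Fin m → MvPolynomial (Fin (n + 1)) K) (a : ℕ) (b : Fin m → ℕ),
    f.IsHomogeneous a ∧ (∀ j, (g j).IsHomogeneous (b j)) ∧ a + ∑ j, b j = i ∧
    w = Ideal.Quotient.mk I f •
      exteriorPower.ιMulti (CoordRing I) m
        (fun j => KaehlerDifferential.D K (CoordRing I) (Ideal.Quotient.mk I (g j)))}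

/-- `HP(Ω^m_{R/K}) = c`, where `R = K[X₀, …, Xₙ] / I`: the homogeneous components of all
sufficiently large degrees are vector spaces of finite dimension `c` over `K`. -/
noncomputable def HasHilbertPolynomial (I : Ideal (MvPolynomial (Fin (n + 1)) K)) (m : ℕ) (c : ℤ) : Prop :=
  ∃ i₀ : ℕ, ∀ i : ℕ, i₀ ≤ i → FiniteDimensional K (homogeneousForms I m i) ∧
    (Module.finrank K (homogeneousForms I m i) : ℤ) = c

end FatPoint

/-! Let P = K[X_0, …, X_n] and let Ω_P be the exterior algebra of its differentials, free on the
dX_S. For R = P/I the forms over R are Ω_P modulo the submodule generated by I Ω_P and dI ∧ Ω_P,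
called `relations I` (`polyFormsToExterior_eq_zero_iff`). The Hilbert function is thus a codimension
inside a finite-dimensional graded piece of Ω_P.

In large degree the problem splits over the points. If I + J contains a power of the irrelevant
ideal, then there `relations I` and `relations J` together span everything and meet in `relations (I
⊓ J)`. The second claim combines the Artin–Rees lemma with `sq_smul_relations_le`. Hence Hilbert
functions add up (`exists_formsHilbert_finset_inf`), and a linear change of coordinates reduces each
summand to the ideal (X_1, …, X_n)^k.

For that ideal, let the tail degree of X^γ be its degree in X_1, …, X_n. Coefficients of tail degree
at least k are zero modulo the relations, and no relation involves a tail degree below k - 1. In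
tail degree k - 1 the relations come from differentials of monomials of tail degree k. Because 1, …,
k are invertible in K, such a relation can be solved for the term whose form part has the least
index (`monoForm_mem_sup`). The surviving monomial forms X^γ dX_S are those where S ⊆ {0} or some
variable of γ other than X_0 precedes all nonzero indices of S. They are independent because the
exterior derivative detects them, while it sends relations to forms of tail degree at least k - 1
(`eq_zero_of_mem_relations`). Counting these normal forms gives the binomial formulas. -/

namespace FatPoint

/-! ### Exterior multiplication on families of coefficients. -/

section Wedge

variable {σ : Type*} [LinearOrder σ] {A : Type*} [CommRing A]

/-- The sign of the shuffle which moves `i` to its place in the ordered set `S`. -/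
def shuffleSign (i : σ) (S : Finset σ) : ℤ := (-1) ^ (S.filter (· < i)).card

lemma shuffleSign_erase_of_lt {i j : σ} {S : Finset σ} (h : i < j) :
    shuffleSign i (S.erase j) = shuffleSign i S := by
  have : (S.erase j).filter (· < i) = S.filter (· < i) := by
    ext a
    simp only [Finset.mem_filter, Finset.mem_erase]
    exact ⟨fun ⟨⟨_, h2⟩, h3⟩ => ⟨h2, h3⟩, fun ⟨h2, h3⟩ => ⟨⟨(h3.trans h).ne, h2⟩, h3⟩⟩
  simp [shuffleSign, this]

lemma shuffleSign_erase_self (i : σ) (S : Finset σ) :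
    shuffleSign i (S.erase i) = shuffleSign i S := by
  have : (S.erase i).filter (· < i) = S.filter (· < i) := by
    ext a
    simp only [Finset.mem_filter, Finset.mem_erase]
    exact ⟨fun ⟨⟨_, h2⟩, h3⟩ => ⟨h2, h3⟩, fun ⟨h2, h3⟩ => ⟨⟨h3.ne, h2⟩, h3⟩⟩
  simp [shuffleSign, this]

lemma shuffleSign_erase_of_gt {i j : σ} {S : Finset σ} (h : i < j) (hi : i ∈ S) :
    shuffleSign j (S.erase i) = -shuffleSign j S := by
  have : S.filter (· < j) = insert i ((S.erase i).filter (· < j)) := by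
    ext a
    simp only [Finset.mem_filter, Finset.mem_erase, Finset.mem_insert]
    by_cases ha : a = i
    · subst ha; simp [hi, h]
    · simp [ha]
  rw [shuffleSign, shuffleSign, this, Finset.card_insert_of_notMem (by simp), pow_succ]
  ring

/-- Left multiplication by `dX_i` on forms `∑ ω_S dX_S`, written as families of coefficients. -/
def wedgeVar (A : Type*) [CommRing A] (i : σ) : (Finset σ → A) →ₗ[A] (Finset σ → A) where
  toFun ω S := if i ∈ S then (shuffleSign i S : A) * ω (S.erase i) else 0
  map_add' ω η := by
    ext S
    by_cases h : i ∈ S <;> simp [h, mul_add]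
  map_smul' c ω := by
    ext S
    by_cases h : i ∈ S <;> simp [h, mul_left_comm]

lemma wedgeVar_apply (i : σ) (ω : Finset σ → A) (S : Finset σ) :
    wedgeVar A i ω S = if i ∈ S then (shuffleSign i S : A) * ω (S.erase i) else 0 := rfl

lemma wedgeVar_single (i : σ) (S : Finset σ) (c : A) (h : i ∉ S) :
    wedgeVar A i (Pi.single S c) = Pi.single (insert i S) ((shuffleSign i S : A) * c) := by
  ext T
  rw [wedgeVar_apply]
  by_cases hT : T = insert i S
  · subst hT
    rw [← shuffleSign_erase_self]
    simp [h]
  · rw [Pi.single_eq_of_ne hT]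
    split_ifs with hi
    · rw [Pi.single_eq_of_ne, mul_zero]
      rintro rfl
      exact hT (Finset.insert_erase hi).symm
    · rfl

lemma wedgeVar_single_of_mem (i : σ) (S : Finset σ) (c : A) (h : i ∈ S) :
    wedgeVar A i (Pi.single S c) = 0 := by
  ext T
  rw [wedgeVar_apply]
  split_ifs with hi
  · rw [Pi.single_eq_of_ne, mul_zero]; · rfl
    rintro rfl
    simp at h
  · rfl

lemma wedgeVar_wedgeVar_self (i : σ) (ω : Finset σ → A) :
    wedgeVar A i (wedgeVar A i ω) = 0 := by
  ext S
  simp [wedgeVar_apply]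

lemma wedgeVar_anticomm_of_lt {i j : σ} (h : i < j) (ω : Finset σ → A) :
    wedgeVar A i (wedgeVar A j ω) = -wedgeVar A j (wedgeVar A i ω) := by
  ext S
  simp only [wedgeVar_apply, Pi.neg_apply, Finset.mem_erase]
  by_cases hi : i ∈ S <;> by_cases hj : j ∈ S <;> simp only [hi, hj, h.ne, h.ne', ne_eq,
    not_false_eq_true, and_self, and_false, if_true, if_false, mul_zero, neg_zero]
  rw [shuffleSign_erase_of_lt h, shuffleSign_erase_of_gt h hi, Finset.erase_right_comm]
  push_cast
  ring

lemma wedgeVar_anticomm (i j : σ) (ω : Finset σ → A) :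
    wedgeVar A i (wedgeVar A j ω) = -wedgeVar A j (wedgeVar A i ω) := by
  rcases lt_trichotomy i j with h | rfl | h
  · exact wedgeVar_anticomm_of_lt h ω
  · simp [wedgeVar_wedgeVar_self]
  · rw [wedgeVar_anticomm_of_lt h, neg_neg]

variable [Fintype σ]

/-- Left multiplication by the one-form `∑ v_i dX_i`. -/
def wedgeVec : (σ → A) →ₗ[A] Module.End A (Finset σ → A) where
  toFun v := ∑ i, v i • wedgeVar A i
  map_add' v w := by simp [add_smul, Finset.sum_add_distrib]
  map_smul' c v := by simp [Finset.smul_sum, mul_smul]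

lemma wedgeVec_apply (v : σ → A) (ω : Finset σ → A) :
    wedgeVec v ω = ∑ i, v i • wedgeVar A i ω := by
  simp [wedgeVec, LinearMap.sum_apply]

/-- Symmetric coefficients meet anticommuting operators, so the pairs (i, j) and (j, i) cancel and
the diagonal vanishes. Cancelling by an involution avoids dividing by 2. This gives both v ∧ v = 0
and, via symmetry of second derivatives, the rule for d(df ∧ ω). -/
lemma sum_sum_smul_wedgeVar {c : σ → σ → A} (hc : ∀ i j, c i j = c j i) (ω : Finset σ → A) :
    ∑ i, ∑ j, c i j • wedgeVar A i (wedgeVar A j ω) = 0 := by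
  rw [← Fintype.sum_prod_type (fun a : σ × σ => c a.1 a.2 • wedgeVar A a.1 (wedgeVar A a.2 ω))]
  refine Finset.sum_involution (fun a _ => (a.2, a.1)) ?_ ?_ (by simp) (by simp)
  · rintro ⟨i, j⟩ _
    rw [wedgeVar_anticomm, hc]
    simp
  · rintro ⟨i, j⟩ _ h1 h2
    obtain rfl : j = i := by simpa using congrArg Prod.fst h2
    simp [wedgeVar_wedgeVar_self] at h1

lemma wedgeVec_wedgeVec_self (v : σ → A) (ω : Finset σ → A) : wedgeVec v (wedgeVec v ω) = 0 := by
  simp only [wedgeVec_apply, map_sum, map_smul, Finset.smul_sum, smul_smul]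
  rw [Finset.sum_comm]
  exact sum_sum_smul_wedgeVar (c := fun i j => v j * v i) (fun i j => mul_comm _ _) ω

lemma wedgeVec_anticomm (v w : σ → A) (ω : Finset σ → A) :
    wedgeVec v (wedgeVec w ω) = -wedgeVec w (wedgeVec v ω) := by
  have h := wedgeVec_wedgeVec_self (v + w) ω
  simp only [map_add, LinearMap.add_apply, wedgeVec_wedgeVec_self, zero_add, add_zero] at h
  exact eq_neg_of_add_eq_zero_right h

end Wedge

/-! ### Comparison with the exterior algebra. -/

section Products

variable {σ : Type*} [LinearOrder σ] {R M : Type*} [CommRing R] [AddCommGroup M] [Module R M]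

lemma ι_mul_ι_anticomm (a b : M) : ExteriorAlgebra.ι R a * ExteriorAlgebra.ι R b =
    -(ExteriorAlgebra.ι R b * ExteriorAlgebra.ι R a) :=
  eq_neg_of_add_eq_zero_left (ExteriorAlgebra.ι_add_mul_swap a b)

/-- The product of the elements `x_s`, for `s ∈ S` in increasing order, in the exterior algebra. -/
def sortedProd (x : σ → M) (S : Finset σ) : ExteriorAlgebra R M :=
  ((S.sort (· ≤ ·)).map fun s => ExteriorAlgebra.ι R (x s)).prod

@[simp] lemma sortedProd_empty (x : σ → M) : sortedProd (R := R) x ∅ = 1 := by simp [sortedProd]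

lemma sortedProd_insert_of_lt (x : σ → M) {a : σ} {S : Finset σ} (h : ∀ b ∈ S, a < b) :
    sortedProd (R := R) x (insert a S) = ExteriorAlgebra.ι R (x a) * sortedProd x S := by
  rw [sortedProd, Finset.sort_insert _ (fun b hb => (h b hb).le) (fun ha => (h a ha).false)]
  simp [sortedProd]

/-- Moving `x i` past each smaller factor costs one sign, which is what `shuffleSign` counts. This
matches `wedgeVar` with multiplication in the exterior algebra. -/
lemma ι_mul_sortedProd (x : σ → M) (i : σ) (S : Finset σ) :
    ExteriorAlgebra.ι R (x i) * sortedProd x S =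
      if i ∈ S then 0 else (shuffleSign i S : R) • sortedProd x (insert i S) := by
  induction S using Finset.induction_on_min with
  | empty => simp [sortedProd, shuffleSign]
  | insert a S ha ih =>
    have haS : a ∉ S := fun h => (ha a h).false
    rcases lt_trichotomy i a with h | rfl | h
    · have hlt : ∀ b ∈ insert a S, i < b := by
        intro b hb
        rcases Finset.mem_insert.1 hb with rfl | hb
        · exact h
        · exact h.trans (ha b hb)
      rw [if_neg fun hi => (hlt i hi).false, sortedProd_insert_of_lt x hlt]
      have : (insert a S).filter (· < i) = ∅ :=
        Finset.filter_false_of_mem fun b hb => (hlt b hb).not_gt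
      simp [shuffleSign, this]
    · rw [sortedProd_insert_of_lt x ha, ← mul_assoc, ExteriorAlgebra.ι_sq_zero]
      simp
    · rw [sortedProd_insert_of_lt x ha, ← mul_assoc, ι_mul_ι_anticomm, neg_mul, mul_assoc, ih]
      by_cases hi : i ∈ S
      · simp [hi]
      · have h1 : i ∉ insert a S := by simp [hi, h.ne']
        rw [if_neg hi, if_neg h1, Finset.insert_comm,
          sortedProd_insert_of_lt x (S := insert i S)]
        · have := shuffleSign_erase_of_gt h (Finset.mem_insert_self a S)
          rw [Finset.erase_insert haS] at this
          rw [this]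
          simp
        · intro b hb
          rcases Finset.mem_insert.1 hb with rfl | hb
          · exact h
          · exact ha b hb

variable [Fintype σ]

/-- The map from families of coefficients to the exterior algebra. -/
def formsToExterior (x : σ → M) : (Finset σ → R) →ₗ[R] ExteriorAlgebra R M where
  toFun ω := ∑ S, ω S • sortedProd x S
  map_add' ω η := by simp [add_smul, Finset.sum_add_distrib]
  map_smul' c ω := by simp [Finset.smul_sum, mul_smul]

lemma formsToExterior_single (x : σ → M) (S : Finset σ) (c : R) :
    formsToExterior x (Pi.single S c) = c • sortedProd x S := by
  simp only [formsToExterior, LinearMap.coe_mk, AddHom.coe_mk]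
  rw [Finset.sum_eq_single S] <;> simp +contextual

lemma formsToExterior_wedgeVar (x : σ → M) (i : σ) (ω : Finset σ → R) :
    formsToExterior x (wedgeVar R i ω) = ExteriorAlgebra.ι R (x i) * formsToExterior x ω := by
  have : formsToExterior x ∘ₗ wedgeVar R i =
      LinearMap.mulLeft R (ExteriorAlgebra.ι R (x i)) ∘ₗ formsToExterior x := by
    refine LinearMap.pi_ext fun S c => ?_
    simp only [LinearMap.comp_apply, LinearMap.mulLeft_apply, formsToExterior_single,
      mul_smul_comm, ι_mul_sortedProd]
    by_cases h : i ∈ S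
    · simp [wedgeVar_single_of_mem, h]
    · rw [wedgeVar_single _ _ _ h, formsToExterior_single, if_neg h, smul_smul, mul_comm]
  exact LinearMap.congr_fun this ω

lemma formsToExterior_wedgeVec (x : σ → M) (v : σ → R) (ω : Finset σ → R) :
    formsToExterior x (wedgeVec v ω) =
      ExteriorAlgebra.ι R (∑ i, v i • x i) * formsToExterior x ω := by
  simp [wedgeVec_apply, formsToExterior_wedgeVar, Finset.sum_mul]

end Products

/-! ### Presentation of the forms over a quotient of the polynomial ring. -/

section Presentation

variable {K : Type*} [Field K] {σ : Type*} [LinearOrder σ] [Fintype σ]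

/-- Left multiplication by `df`, for a polynomial `f`. -/
noncomputable def wedgeDiff (f : MvPolynomial σ K) :
    Module.End (MvPolynomial σ K) (Finset σ → MvPolynomial σ K) :=
  wedgeVec fun i => MvPolynomial.pderiv i f

/-- The submodule generated by `I` and `dI` in the forms over the polynomial ring. -/
noncomputable def relations (I : Ideal (MvPolynomial σ K)) :
    Submodule (MvPolynomial σ K) (Finset σ → MvPolynomial σ K) :=
  Submodule.span _ ({ω | ∀ S, ω S ∈ I} ∪ {ω | ∃ f ∈ I, ∃ η, ω = wedgeDiff f η})

lemma mem_relations_of_forall_mem {I : Ideal (MvPolynomial σ K)}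
    {ω : Finset σ → MvPolynomial σ K} (h : ∀ S, ω S ∈ I) : ω ∈ relations I :=
  Submodule.subset_span (Or.inl h)

lemma wedgeDiff_mem_relations {I : Ideal (MvPolynomial σ K)} {f : MvPolynomial σ K} (hf : f ∈ I)
    (η : Finset σ → MvPolynomial σ K) : wedgeDiff f η ∈ relations I :=
  Submodule.subset_span (Or.inr ⟨f, hf, η, rfl⟩)

variable {R : Type*} [CommRing R] [Algebra K R] (π : MvPolynomial σ K →ₐ[K] R)

/-- The gradient of `f`, with entries in `R`. -/
noncomputable def gradient : MvPolynomial σ K →ₗ[K] (σ → R) :=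
  LinearMap.pi fun i => π.toLinearMap ∘ₗ (MvPolynomial.pderiv i).toLinearMap

omit [LinearOrder σ] [Fintype σ] in
lemma gradient_apply (f : MvPolynomial σ K) (i : σ) :
    gradient π f i = π (MvPolynomial.pderiv i f) := rfl

omit [LinearOrder σ] [Fintype σ] in
lemma gradient_mul (f g : MvPolynomial σ K) :
    gradient π (f * g) = π f • gradient π g + π g • gradient π f := by
  ext i
  simp [gradient_apply, Derivation.leibniz]

/-- The submodule generated by `dI` in the forms over `R`, where `I` is the kernel of `π`. -/
noncomputable def diffRelations : Submodule R (Finset σ → R) :=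
  Submodule.span R {ω | ∃ f, π f = 0 ∧ ∃ η, ω = wedgeVec (gradient π f) η}

/-- A one-form can be moved past df at the price of a sign, so the span of the df ∧ η is stable
under left multiplication. -/
lemma diffRelations_le_comap (v : σ → R) :
    diffRelations π ≤ (diffRelations π).comap (wedgeVec v) := by
  refine Submodule.span_le.2 ?_
  rintro _ ⟨f, hf, η, rfl⟩
  simp only [Submodule.comap_coe, Set.mem_preimage, SetLike.mem_coe]
  rw [wedgeVec_anticomm]
  exact neg_mem (Submodule.subset_span ⟨f, hf, _, rfl⟩)

/-- The action of one-forms with coefficients in `R` on forms modulo the relations. -/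
noncomputable def wedgeQuot :
    (σ → R) →ₗ[R] Module.End R ((Finset σ → R) ⧸ diffRelations π) where
  toFun v := (diffRelations π).mapQ (diffRelations π) (wedgeVec v) (diffRelations_le_comap π v)
  map_add' v w := by
    refine Submodule.linearMap_qext _ (LinearMap.ext fun ω => ?_)
    simp
  map_smul' c v := by
    refine Submodule.linearMap_qext _ (LinearMap.ext fun ω => ?_)
    simp

lemma wedgeQuot_mk (v : σ → R) (ω : Finset σ → R) :
    wedgeQuot π v ((diffRelations π).mkQ ω) = (diffRelations π).mkQ (wedgeVec v ω) := rfl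

lemma wedgeQuot_gradient {f : MvPolynomial σ K} (hf : π f = 0) :
    wedgeQuot π (gradient π f) = 0 := by
  refine Submodule.linearMap_qext _ (LinearMap.ext fun ω => ?_)
  simp only [LinearMap.comp_apply, wedgeQuot_mk]
  exact (Submodule.Quotient.mk_eq_zero _).2 (Submodule.subset_span ⟨f, hf, ω, rfl⟩)

variable {π} (hπ : Function.Surjective π)

/-- Makes "multiplication by dr" independent of the polynomial lifting r, which gives additivity and
the Leibniz rule for `wedgeDerivation`. -/
lemma wedgeQuot_gradient_congr {f g : MvPolynomial σ K} (h : π f = π g) :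
    wedgeQuot π (gradient π f) = wedgeQuot π (gradient π g) := by
  rw [← sub_eq_zero, ← map_sub, ← map_sub]
  exact wedgeQuot_gradient π (by simp [h])

/-- The derivation which sends `g` to left multiplication by `dg`. -/
noncomputable def wedgeDerivation :
    Derivation K R (Module.End R ((Finset σ → R) ⧸ diffRelations π)) :=
  Derivation.mk'
    { toFun := fun r => wedgeQuot π (gradient π (Function.surjInv hπ r))
      map_add' := fun a b => by
        rw [← map_add, ← map_add]
        exact wedgeQuot_gradient_congr (by simp [Function.surjInv_eq])
      map_smul' := fun c a => by
        rw [RingHom.id_apply, ← LinearMap.map_smul_of_tower, ← map_smul]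
        exact wedgeQuot_gradient_congr (by simp [Function.surjInv_eq]) }
    fun a b => by
      simp only [LinearMap.coe_mk, AddHom.coe_mk]
      rw [wedgeQuot_gradient_congr (g := Function.surjInv hπ a * Function.surjInv hπ b)
        (by simp [Function.surjInv_eq]), gradient_mul]
      simp [Function.surjInv_eq]

lemma wedgeDerivation_apply (f : MvPolynomial σ K) :
    wedgeDerivation hπ (π f) = wedgeQuot π (gradient π f) :=
  wedgeQuot_gradient_congr (by simp [Function.surjInv_eq])

/-- Operators of the form `wedgeQuot π v` square to zero, which is the condition needed to extend
the action from Ω to its exterior algebra. -/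
lemma liftKaehlerDifferential_mem_range (w : Ω[R⁄K]) :
    ∃ v, (wedgeDerivation hπ).liftKaehlerDifferential w = wedgeQuot π v := by
  have h : w ∈ Submodule.span R (Set.range (KaehlerDifferential.D K R)) := by
    rw [KaehlerDifferential.span_range_derivation]; trivial
  induction h using Submodule.span_induction with
  | mem x hx =>
    obtain ⟨r, rfl⟩ := hx
    obtain ⟨f, rfl⟩ := hπ r
    exact ⟨gradient π f, by rw [Derivation.liftKaehlerDifferential_comp_D, wedgeDerivation_apply]⟩
  | zero => exact ⟨0, by simp⟩
  | add x y _ _ hx hy =>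
    obtain ⟨v, hv⟩ := hx
    obtain ⟨w, hw⟩ := hy
    exact ⟨v + w, by rw [map_add, map_add, hv, hw]⟩
  | smul c x _ hx =>
    obtain ⟨v, hv⟩ := hx
    exact ⟨c • v, by rw [map_smul, map_smul, hv]⟩

/-- The action of the exterior algebra of the Kähler differentials on forms modulo relations. -/
noncomputable def exteriorAction :
    ExteriorAlgebra R Ω[R⁄K] →ₐ[R] Module.End R ((Finset σ → R) ⧸ diffRelations π) :=
  ExteriorAlgebra.lift R ⟨(wedgeDerivation hπ).liftKaehlerDifferential, fun w => by
    obtain ⟨v, hv⟩ := liftKaehlerDifferential_mem_range hπ w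
    rw [hv]
    refine Submodule.linearMap_qext _ (LinearMap.ext fun ω => ?_)
    simp only [LinearMap.comp_apply, Module.End.mul_apply, wedgeQuot_mk, wedgeVec_wedgeVec_self]
    simp⟩

lemma exteriorAction_ι_D (f : MvPolynomial σ K) :
    exteriorAction hπ (ExteriorAlgebra.ι R (KaehlerDifferential.D K R (π f))) =
      wedgeQuot π (gradient π f) := by
  rw [exteriorAction, ExteriorAlgebra.lift_ι_apply, Derivation.liftKaehlerDifferential_comp_D,
    wedgeDerivation_apply]

variable (π)

/-- The differentials of the images of the variables. -/
noncomputable def diffVar (i : σ) : Ω[R⁄K] := KaehlerDifferential.D K R (π (MvPolynomial.X i))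

lemma D_eq_sum_gradient (f : MvPolynomial σ K) :
    KaehlerDifferential.D K R (π f) = ∑ i, gradient π f i • diffVar π i := by
  induction f using MvPolynomial.induction_on with
  | C a =>
    have : π (MvPolynomial.C a) = algebraMap K R a := π.commutes a
    simp [gradient_apply, this]
  | add p q hp hq => simp [hp, hq, add_smul, Finset.sum_add_distrib]
  | mul_X p i hp =>
    rw [gradient_mul, map_mul, Derivation.leibniz, hp]
    simp only [Pi.add_apply, Pi.smul_apply, add_smul, Finset.sum_add_distrib, smul_eq_mul,
      mul_smul, ← Finset.smul_sum]
    congr 2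
    rw [Finset.sum_eq_single i]
    · simp [gradient_apply, diffVar]
    · intro j _ hj
      simp [gradient_apply, MvPolynomial.pderiv_X_of_ne hj.symm]
    · simp

lemma diffRelations_le_ker : diffRelations π ≤ LinearMap.ker (formsToExterior (diffVar π)) := by
  refine Submodule.span_le.2 ?_
  rintro _ ⟨f, hf, η, rfl⟩
  simp only [SetLike.mem_coe, LinearMap.mem_ker]
  rw [formsToExterior_wedgeVec, ← D_eq_sum_gradient, hf]
  simp

/-- The map from forms modulo relations to the exterior algebra of the Kähler differentials. -/
noncomputable def quotToExterior :
    ((Finset σ → R) ⧸ diffRelations π) →ₗ[R] ExteriorAlgebra R Ω[R⁄K] :=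
  (diffRelations π).liftQ (formsToExterior (diffVar π)) (diffRelations_le_ker π)

lemma quotToExterior_mk (ω : Finset σ → R) :
    quotToExterior π ((diffRelations π).mkQ ω) = formsToExterior (diffVar π) ω := rfl

variable {π}

/-- The smallest index is multiplied on last, from the left, so no sign arises at any stage. -/
lemma exteriorAction_sortedProd (S : Finset σ) :
    exteriorAction hπ (sortedProd (diffVar π) S) ((diffRelations π).mkQ (Pi.single ∅ 1)) =
      (diffRelations π).mkQ (Pi.single S 1) := by
  induction S using Finset.induction_on_min with
  | empty => simp
  | insert a S ha ih =>
    have haS : a ∉ S := fun h => (ha a h).false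
    have hg : gradient π (MvPolynomial.X a) = Pi.single a 1 := by
      ext i
      by_cases h : i = a
      · subst h; simp [gradient_apply]
      · simp [gradient_apply, h, MvPolynomial.pderiv_X_of_ne (Ne.symm h)]
    have hw : wedgeVec (Pi.single a (1 : R)) = wedgeVar R a := by
      ext1 i
      rw [wedgeVec]
      simp [Pi.single_apply]
    have hs : S.filter (· < a) = ∅ := Finset.filter_false_of_mem fun b hb => (ha b hb).not_gt
    rw [sortedProd_insert_of_lt _ ha, map_mul, Module.End.mul_apply, ih, diffVar,
      exteriorAction_ι_D, wedgeQuot_mk, hg, hw, wedgeVar_single _ _ _ haS]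
    simp [shuffleSign, hs]

/-- Acting on the unit form is a left inverse of `quotToExterior`. Hence that map is injective, and
there are no relations among the forms over R beyond those in `diffRelations`. -/
lemma exteriorAction_quotToExterior (q : (Finset σ → R) ⧸ diffRelations π) :
    exteriorAction hπ (quotToExterior π q) ((diffRelations π).mkQ (Pi.single ∅ 1)) = q := by
  obtain ⟨ω, rfl⟩ := Submodule.mkQ_surjective _ q
  rw [quotToExterior_mk]
  simp only [formsToExterior, LinearMap.coe_mk, AddHom.coe_mk, map_sum, map_smul,
    LinearMap.sum_apply, LinearMap.smul_apply, exteriorAction_sortedProd]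
  simp only [← map_smul, ← map_sum]
  congr 1
  ext S
  simp [Finset.sum_apply, Pi.single_apply]

/-- The map from forms over the polynomial ring to the exterior algebra of the Kähler
differentials of `R`. -/
noncomputable def polyFormsToExterior (π : MvPolynomial σ K →ₐ[K] R) :
    (Finset σ → MvPolynomial σ K) →ₗ[K] ExteriorAlgebra R Ω[R⁄K] :=
  (formsToExterior (diffVar π)).restrictScalars K ∘ₗ
    LinearMap.pi fun S => π.toLinearMap ∘ₗ LinearMap.proj S

lemma polyFormsToExterior_apply (ω : Finset σ → MvPolynomial σ K) :
    polyFormsToExterior π ω = formsToExterior (diffVar π) (fun S => π (ω S)) := rfl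

omit [Fintype σ] in
lemma comp_wedgeVar (i : σ) (ω : Finset σ → MvPolynomial σ K) :
    (fun S => π (wedgeVar _ i ω S)) = wedgeVar R i (fun S => π (ω S)) := by
  ext S
  simp only [wedgeVar_apply]
  split_ifs <;> simp

lemma comp_wedgeDiff (f : MvPolynomial σ K) (ω : Finset σ → MvPolynomial σ K) :
    (fun S => π (wedgeDiff f ω S)) = wedgeVec (gradient π f) (fun S => π (ω S)) := by
  ext S
  simp only [wedgeDiff, wedgeVec_apply, Finset.sum_apply, Pi.smul_apply, map_sum, smul_eq_mul,
    map_mul, gradient_apply]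
  refine Finset.sum_congr rfl fun i _ => ?_
  rw [← comp_wedgeVar]

lemma polyFormsToExterior_wedgeDiff (f : MvPolynomial σ K) (ω : Finset σ → MvPolynomial σ K) :
    polyFormsToExterior π (wedgeDiff f ω) =
      ExteriorAlgebra.ι R (KaehlerDifferential.D K R (π f)) * polyFormsToExterior π ω := by
  rw [polyFormsToExterior_apply, comp_wedgeDiff, formsToExterior_wedgeVec, ← D_eq_sum_gradient]
  rfl

lemma polyFormsToExterior_eq_zero_iff (hπ : Function.Surjective π)
    (ω : Finset σ → MvPolynomial σ K) :
    polyFormsToExterior π ω = 0 ↔ ω ∈ relations (RingHom.ker π) := by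
  constructor
  · intro h
    have h1 : (fun S => π (ω S)) ∈ diffRelations π := by
      have := exteriorAction_quotToExterior hπ ((diffRelations π).mkQ fun S => π (ω S))
      rw [quotToExterior_mk, ← polyFormsToExterior_apply, h] at this
      simpa using this.symm
    -- Relations over R lift to relations over P; two lifts of the same family differ by
    -- coefficients in the kernel, which are relations too.
    have key : ∀ η ∈ diffRelations π, ∃ η' ∈ relations (RingHom.ker π), η = fun S => π (η' S) := by
      intro η hη
      induction hη using Submodule.span_induction with
      | mem x hx =>
        obtain ⟨f, hf, η, rfl⟩ := hx
        choose η' hη' using fun S => hπ (η S)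
        refine ⟨wedgeDiff f η', wedgeDiff_mem_relations hf _, ?_⟩
        rw [comp_wedgeDiff]
        simp [hη']
      | zero => exact ⟨0, zero_mem _, by ext; simp⟩
      | add x y _ _ hx hy =>
        obtain ⟨x', hx', rfl⟩ := hx
        obtain ⟨y', hy', rfl⟩ := hy
        exact ⟨x' + y', add_mem hx' hy', by ext; simp⟩
      | smul c x _ hx =>
        obtain ⟨x', hx', rfl⟩ := hx
        obtain ⟨c, rfl⟩ := hπ c
        exact ⟨c • x', Submodule.smul_mem _ _ hx', by ext; simp⟩
    obtain ⟨η, hη, hη'⟩ := key _ h1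
    rw [← sub_add_cancel ω η]
    refine add_mem (mem_relations_of_forall_mem fun S => ?_) hη
    simpa [sub_eq_zero] using congrFun hη' S
  · intro h
    induction h using Submodule.span_induction with
    | mem x hx =>
      rcases hx with hx | ⟨f, hf, η, rfl⟩
      · have : (fun S => π (x S)) = 0 := funext fun S => hx S
        rw [polyFormsToExterior_apply, this, map_zero]
      · rw [polyFormsToExterior_wedgeDiff, show π f = 0 from hf]
        simp
    | zero => simp
    | add x y _ _ hx hy => rw [map_add, hx, hy, add_zero]
    | smul c x _ hx =>
      have : (fun S => π ((c • x) S)) = π c • fun S => π (x S) := by ext; simp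
      rw [polyFormsToExterior_apply, this, map_smul, ← polyFormsToExterior_apply, hx, smul_zero]

end Presentation

/-! ### Graded pieces and Hilbert functions. -/

section Graded

variable {K : Type*} [Field K] {σ : Type*}

lemma coeff_pderiv_ne_zero {f : MvPolynomial σ K} {i : σ} {γ : σ →₀ ℕ}
    (h : (MvPolynomial.pderiv i f).coeff γ ≠ 0) : f.coeff (γ + Finsupp.single i 1) ≠ 0 := by
  rw [MvPolynomial.coeff_pderiv] at h
  exact left_ne_zero_of_mul h

lemma degree_eq_of_coeff_ne_zero {f : MvPolynomial σ K} {a : ℕ} (hf : f.IsHomogeneous a)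
    {γ : σ →₀ ℕ} (h : f.coeff γ ≠ 0) : γ.degree = a := by
  by_contra hne
  exact h (hf.coeff_eq_zero hne)

lemma coeff_intCast_mul (z : ℤ) (f : MvPolynomial σ K) (γ : σ →₀ ℕ) :
    ((z : MvPolynomial σ K) * f).coeff γ = z * f.coeff γ := by
  rw [← map_intCast (MvPolynomial.C (σ := σ) (R := K)), MvPolynomial.coeff_C_mul]

lemma exists_coeff_ne_zero_of_mul {f g : MvPolynomial σ K} {γ : σ →₀ ℕ}
    (h : (f * g).coeff γ ≠ 0) : ∃ α β, α + β = γ ∧ f.coeff α ≠ 0 ∧ g.coeff β ≠ 0 := by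
  classical
  rw [MvPolynomial.coeff_mul] at h
  obtain ⟨⟨α, β⟩, hab, hne⟩ := Finset.exists_ne_zero_of_sum_ne_zero h
  exact ⟨α, β, Finset.HasAntidiagonal.mem_antidiagonal.1 hab, left_ne_zero_of_mul hne,
    right_ne_zero_of_mul hne⟩

/-- The forms of degree `m` whose total degree is `i`, where `dX_S` has degree `|S|`. -/
def gradedForms (K σ : Type*) [Field K] (m i : ℕ) : Submodule K (Finset σ → MvPolynomial σ K) where
  carrier := {ω | ∀ S γ, (ω S).coeff γ ≠ 0 → S.card = m ∧ γ.degree + m = i}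
  zero_mem' S γ h := by simp at h
  add_mem' {ω η} hω hη S γ h := by
    by_cases h1 : (ω S).coeff γ = 0
    · exact hη S γ fun h2 => h (by simp [h1, h2])
    · exact hω S γ h1
  smul_mem' c ω hω S γ h := hω S γ fun h2 => h (by simp [h2])

variable [LinearOrder σ] [Fintype σ]

lemma wedgeDiff_mem_gradedForms {m i b : ℕ} {ω : Finset σ → MvPolynomial σ K}
    (hω : ω ∈ gradedForms K σ m i) {g : MvPolynomial σ K} (hg : g.IsHomogeneous b) :
    wedgeDiff g ω ∈ gradedForms K σ (m + 1) (b + i) := by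
  rw [wedgeDiff, wedgeVec_apply]
  refine sum_mem fun j _ => ?_
  intro S γ h
  rw [Pi.smul_apply, wedgeVar_apply] at h
  split_ifs at h with hj
  · rw [smul_eq_mul, mul_left_comm, coeff_intCast_mul] at h
    obtain ⟨α, β, rfl, hα, hβ⟩ := exists_coeff_ne_zero_of_mul (right_ne_zero_of_mul h)
    have h1 := degree_eq_of_coeff_ne_zero hg (coeff_pderiv_ne_zero hα)
    have h2 := hω _ _ hβ
    rw [Finset.card_erase_of_mem hj] at h2
    have h3 := Finset.card_pos.2 ⟨j, hj⟩
    rw [map_add, Finsupp.degree_single] at h1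
    rw [map_add]
    omega
  · simp at h

/-- The form `X^γ dX_S`. -/
noncomputable def monoForm (K : Type*) [Field K] (b : Finset σ × (σ →₀ ℕ)) :
    Finset σ → MvPolynomial σ K :=
  Pi.single b.1 (MvPolynomial.monomial b.2 1)

lemma eq_sum_monoForm (ω : Finset σ → MvPolynomial σ K) :
    ω = ∑ S, ∑ γ ∈ (ω S).support, (ω S).coeff γ • monoForm K (S, γ) := by
  ext1 T
  rw [Finset.sum_apply, Finset.sum_eq_single T]
  · rw [Finset.sum_apply]
    conv_lhs => rw [(ω T).as_sum]
    refine Finset.sum_congr rfl fun γ _ => ?_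
    simp [monoForm, MvPolynomial.smul_monomial]
  · intro S _ hS
    simp [monoForm, hS.symm]
  · simp

lemma gradedForms_eq_span (m i : ℕ) : gradedForms K σ m i =
    Submodule.span K (monoForm K '' {b | b.1.card = m ∧ b.2.degree + m = i}) := by
  apply le_antisymm
  · intro ω hω
    rw [eq_sum_monoForm ω]
    refine sum_mem fun S _ => sum_mem fun γ hγ => Submodule.smul_mem _ _ (Submodule.subset_span ?_)
    exact ⟨(S, γ), hω S γ (MvPolynomial.mem_support_iff.1 hγ), rfl⟩
  · rw [Submodule.span_le]
    rintro _ ⟨⟨S, γ⟩, hb, rfl⟩ T δ h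
    by_cases hT : T = S
    · subst hT
      simp only [monoForm, Pi.single_eq_same, MvPolynomial.coeff_monomial] at h
      obtain rfl : γ = δ := by by_contra hne; simp [hne] at h
      exact hb
    · simp [monoForm, hT] at h

omit [LinearOrder σ] in
lemma finite_degree_indices (m i : ℕ) :
    {b : Finset σ × (σ →₀ ℕ) | b.1.card = m ∧ b.2.degree + m = i}.Finite :=
  (Set.finite_univ.prod (Finsupp.finite_of_degree_le i)).subset fun b hb => by
    simp only [Set.mem_prod, Set.mem_univ, true_and, Set.mem_ofPred_eq]
    have := hb.2
    omega

instance finiteDimensional_gradedForms (m i : ℕ) : FiniteDimensional K (gradedForms K σ m i) := by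
  rw [gradedForms_eq_span]
  exact FiniteDimensional.span_of_finite K ((finite_degree_indices m i).image _)

variable {R : Type*} [CommRing R] [Algebra K R]

/-- The homogeneous `m`-forms of degree `i` over `R`, in the exterior algebra, where the
homogeneous elements of `R` are the images of the homogeneous polynomials. -/
noncomputable def homogeneousExterior (π : MvPolynomial σ K →ₐ[K] R) (m i : ℕ) :
    Submodule K (ExteriorAlgebra R Ω[R⁄K]) :=
  Submodule.span K {w | ∃ (f : MvPolynomial σ K) (g : Fin m → MvPolynomial σ K) (a : ℕ)
    (b : Fin m → ℕ), f.IsHomogeneous a ∧ (∀ j, (g j).IsHomogeneous (b j)) ∧ a + ∑ j, b j = i ∧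
    w = π f • ExteriorAlgebra.ιMulti R m (fun j => KaehlerDifferential.D K R (π (g j)))}

/-- Multiplication by dg raises the total degree by exactly deg g: the derivative loses one degree
and dX_j restores it. -/
lemma exists_polyFormsToExterior_eq (π : MvPolynomial σ K →ₐ[K] R) {f : MvPolynomial σ K} {a : ℕ}
    (hf : f.IsHomogeneous a) (m : ℕ) (g : Fin m → MvPolynomial σ K) (b : Fin m → ℕ)
    (hg : ∀ j, (g j).IsHomogeneous (b j)) :
    ∃ ω ∈ gradedForms K σ m (a + ∑ j, b j), polyFormsToExterior π ω =
      π f • ExteriorAlgebra.ιMulti R m (fun j => KaehlerDifferential.D K R (π (g j))) := by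
  induction m with
  | zero =>
    refine ⟨Pi.single ∅ f, fun S γ h => ?_, ?_⟩
    · by_cases hS : S = ∅
      · subst hS
        rw [Pi.single_eq_same] at h
        simpa using degree_eq_of_coeff_ne_zero hf h
      · simp [hS] at h
    · have : (fun S => π ((Pi.single ∅ f : Finset σ → MvPolynomial σ K) S)) =
          Pi.single ∅ (π f) := by
        ext S
        by_cases h : S = ∅
        · subst h; simp
        · simp [h]
      rw [polyFormsToExterior_apply, this, formsToExterior_single]
      simp [ExteriorAlgebra.ιMulti_apply]
  | succ m ih =>
    obtain ⟨ω, hω, h⟩ := ih (fun j => g j.succ) (fun j => b j.succ) fun j => hg j.succ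
    refine ⟨wedgeDiff (g 0) ω, ?_, ?_⟩
    · rw [Fin.sum_univ_succ, add_left_comm]
      exact wedgeDiff_mem_gradedForms hω (hg 0)
    · rw [polyFormsToExterior_wedgeDiff, h, mul_smul_comm, ExteriorAlgebra.ιMulti_apply,
        ExteriorAlgebra.ιMulti_apply, List.ofFn_succ, List.prod_cons]

omit [Fintype σ] in
lemma sortedProd_eq_ιMulti {M : Type*} [AddCommGroup M] [Module R M] (x : σ → M) (S : Finset σ) :
    sortedProd (R := R) x S =
      ExteriorAlgebra.ιMulti R S.card fun j => x (S.orderEmbOfFin rfl j) := by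
  rw [sortedProd, ExteriorAlgebra.ιMulti_apply]
  congr 1
  refine List.ext_getElem (by simp) fun j h1 h2 => ?_
  simp [Finset.orderEmbOfFin_apply]

lemma polyFormsToExterior_monoForm (π : MvPolynomial σ K →ₐ[K] R) (b : Finset σ × (σ →₀ ℕ)) :
    polyFormsToExterior π (monoForm K b) =
      π (MvPolynomial.monomial b.2 1) • sortedProd (diffVar π) b.1 := by
  have : (fun S => π (monoForm K b S)) =
      Pi.single b.1 (π (MvPolynomial.monomial b.2 1)) := by
    ext S
    by_cases h : S = b.1
    · subst h; simp [monoForm]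
    · simp [monoForm, h]
  rw [polyFormsToExterior_apply, this, formsToExterior_single]

lemma homogeneousExterior_eq_map (π : MvPolynomial σ K →ₐ[K] R) (m i : ℕ) :
    homogeneousExterior π m i = (gradedForms K σ m i).map (polyFormsToExterior π) := by
  apply le_antisymm
  · refine Submodule.span_le.2 ?_
    rintro _ ⟨f, g, a, b, hf, hg, rfl, rfl⟩
    obtain ⟨ω, hω, h⟩ := exists_polyFormsToExterior_eq π hf m g b hg
    exact ⟨ω, hω, h⟩
  · rw [gradedForms_eq_span, Submodule.map_span_le]
    rintro _ ⟨⟨S, γ⟩, ⟨rfl, hb⟩, rfl⟩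
    rw [polyFormsToExterior_monoForm, sortedProd_eq_ιMulti]
    refine Submodule.subset_span ⟨_, fun j => MvPolynomial.X (S.orderEmbOfFin rfl j), γ.degree,
      fun _ => 1, MvPolynomial.isHomogeneous_monomial _ rfl,
      fun j => MvPolynomial.isHomogeneous_X _ _, by simpa using hb, rfl⟩

/-- The Hilbert function of the module of `m`-forms of `K[X] / I`. -/
noncomputable def formsHilbert (I : Ideal (MvPolynomial σ K)) (m i : ℕ) : ℕ :=
  Module.finrank K ((gradedForms K σ m i).map ((relations I).mkQ.restrictScalars K))

/-- Both images are the quotient of `U` by the same kernel. -/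
lemma finrank_map_eq_of_ker_eq {V W W' : Type*} [AddCommGroup V] [Module K V] [AddCommGroup W]
    [Module K W] [AddCommGroup W'] [Module K W'] (f : V →ₗ[K] W) (g : V →ₗ[K] W')
    (h : ∀ v, f v = 0 ↔ g v = 0) (U : Submodule K V) :
    Module.finrank K (U.map f) = Module.finrank K (U.map g) := by
  have h' : LinearMap.ker (f.domRestrict U) = LinearMap.ker (g.domRestrict U) := by
    ext v; simp [h]
  have e1 := (f.domRestrict U).quotKerEquivRange
  have e2 := (g.domRestrict U).quotKerEquivRange
  rw [LinearMap.range_domRestrict] at e1 e2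
  exact (e1.symm.trans ((Submodule.quotEquivOfEq _ _ h').trans e2)).finrank_eq

lemma finrank_homogeneousExterior {π : MvPolynomial σ K →ₐ[K] R} (hπ : Function.Surjective π)
    (m i : ℕ) : Module.finrank K (homogeneousExterior π m i) =
      formsHilbert (RingHom.ker π) m i := by
  rw [homogeneousExterior_eq_map, formsHilbert]
  refine finrank_map_eq_of_ker_eq _ _ (fun ω => ?_) _
  rw [polyFormsToExterior_eq_zero_iff hπ]
  simp

omit [LinearOrder σ] [Fintype σ] in
lemma homogeneousExterior_comp_le (π : MvPolynomial σ K →ₐ[K] R)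
    (E : MvPolynomial σ K →ₐ[K] MvPolynomial σ K)
    (hE : ∀ f d, f.IsHomogeneous d → (E f).IsHomogeneous d) (m i : ℕ) :
    homogeneousExterior (π.comp E) m i ≤ homogeneousExterior π m i := by
  refine Submodule.span_le.2 ?_
  rintro _ ⟨f, g, a, b, hf, hg, h, rfl⟩
  exact Submodule.subset_span
    ⟨E f, fun j => E (g j), a, b, hE _ _ hf, fun j => hE _ _ (hg j), h, rfl⟩

omit [LinearOrder σ] [Fintype σ] in
lemma ker_mkₐ (I : Ideal (MvPolynomial σ K)) : RingHom.ker (Ideal.Quotient.mkₐ K I) = I := by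
  ext f
  simp [RingHom.mem_ker, Ideal.Quotient.eq_zero_iff_mem]

/-- `I.comap E` is the kernel of P → P/I precomposed with `E`, so both ideals present the same ring.
As `E` and its inverse preserve degrees, both presentations define the same homogeneous forms. -/
lemma formsHilbert_comap (E : MvPolynomial σ K ≃ₐ[K] MvPolynomial σ K)
    (hE : ∀ f d, f.IsHomogeneous d → (E f).IsHomogeneous d)
    (hE' : ∀ f d, f.IsHomogeneous d → (E.symm f).IsHomogeneous d)
    (I : Ideal (MvPolynomial σ K)) (m i : ℕ) :
    formsHilbert (I.comap E) m i = formsHilbert I m i := by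
  have h : homogeneousExterior ((Ideal.Quotient.mkₐ K I).comp E.toAlgHom) m i =
      homogeneousExterior (Ideal.Quotient.mkₐ K I) m i := by
    refine le_antisymm (homogeneousExterior_comp_le _ _ hE m i) ?_
    have := homogeneousExterior_comp_le ((Ideal.Quotient.mkₐ K I).comp E.toAlgHom)
      E.symm.toAlgHom hE' m i
    rwa [AlgHom.comp_assoc, show E.toAlgHom.comp E.symm.toAlgHom = AlgHom.id _ _ from
      AlgHom.ext E.apply_symm_apply, AlgHom.comp_id] at this
  have h1 : RingHom.ker ((Ideal.Quotient.mkₐ K I).comp E.toAlgHom) = I.comap E := by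
    ext f
    simp [RingHom.mem_ker, Ideal.Quotient.eq_zero_iff_mem]
  rw [← h1, ← finrank_homogeneousExterior, h, finrank_homogeneousExterior, ker_mkₐ]
  · exact Ideal.Quotient.mkₐ_surjective K I
  · exact (Ideal.Quotient.mkₐ_surjective K I).comp E.surjective

end Graded

/-! ### Translation of the Hilbert polynomial into codimensions of relations. -/

variable {K : Type*} [Field K] {n : ℕ}

lemma map_homogeneousForms (I : Ideal (MvPolynomial (Fin (n + 1)) K)) (m i : ℕ) :
    (homogeneousForms I m i).map
      ((⋀[CoordRing I]^m (Ω[CoordRing I⁄K])).subtype.restrictScalars K) =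
      homogeneousExterior (Ideal.Quotient.mkₐ K I) m i := by
  rw [homogeneousForms, Submodule.map_span, homogeneousExterior]
  congr 1
  ext w
  constructor
  · rintro ⟨_, ⟨f, g, a, b, hf, hg, h, rfl⟩, rfl⟩
    exact ⟨f, g, a, b, hf, hg, h, rfl⟩
  · rintro ⟨f, g, a, b, hf, hg, h, rfl⟩
    exact ⟨_, ⟨f, g, a, b, hf, hg, h, rfl⟩, rfl⟩

lemma hasHilbertPolynomial_iff (I : Ideal (MvPolynomial (Fin (n + 1)) K)) (m : ℕ) (c : ℤ) :
    HasHilbertPolynomial I m c ↔ ∃ i₀ : ℕ, ∀ i, i₀ ≤ i → (formsHilbert I m i : ℤ) = c := by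
  have e : ∀ i, homogeneousForms I m i ≃ₗ[K]
      homogeneousExterior (Ideal.Quotient.mkₐ K I) m i := fun i =>
    (Submodule.equivMapOfInjective
      ((⋀[CoordRing I]^m (Ω[CoordRing I⁄K])).subtype.restrictScalars K)
      Subtype.val_injective _).trans (LinearEquiv.ofEq _ _ (map_homogeneousForms I m i))
  have hfin : ∀ i, FiniteDimensional K (homogeneousForms I m i) := fun i => by
    have : FiniteDimensional K (homogeneousExterior (Ideal.Quotient.mkₐ K I) m i) := by
      rw [homogeneousExterior_eq_map]
      infer_instance
    exact LinearEquiv.finiteDimensional (e i).symm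
  have hrank : ∀ i, Module.finrank K (homogeneousForms I m i) = formsHilbert I m i := fun i => by
    rw [(e i).finrank_eq, finrank_homogeneousExterior (Ideal.Quotient.mkₐ_surjective K I),
      ker_mkₐ]
  simp [HasHilbertPolynomial, hfin, hrank]

/-! ### Additivity of the Hilbert function over comaximal-up-to-irrelevant ideals. -/

section Gluing

variable {K : Type*} [Field K] {σ : Type*} [LinearOrder σ] [Fintype σ]

lemma wedgeDiff_mul (f g : MvPolynomial σ K) (η : Finset σ → MvPolynomial σ K) :
    wedgeDiff (f * g) η = f • wedgeDiff g η + g • wedgeDiff f η := by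
  have : (fun i => MvPolynomial.pderiv i (f * g)) =
      f • (fun i => MvPolynomial.pderiv i g) + g • fun i => MvPolynomial.pderiv i f := by
    ext1 i
    simp [Derivation.leibniz]
  rw [wedgeDiff, this, map_add, map_smul, map_smul]
  rfl

lemma smul_mem_relations {I : Ideal (MvPolynomial σ K)} {f : MvPolynomial σ K} (hf : f ∈ I)
    (ω : Finset σ → MvPolynomial σ K) : f • ω ∈ relations I :=
  mem_relations_of_forall_mem fun S => I.mul_mem_right (ω S) hf

lemma relations_mono {I J : Ideal (MvPolynomial σ K)} (h : I ≤ J) : relations I ≤ relations J := by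
  refine Submodule.span_mono ?_
  rintro ω (hω | ⟨f, hf, η, rfl⟩)
  · exact Or.inl fun S => h (hω S)
  · exact Or.inr ⟨f, h hf, η, rfl⟩

/-- For f, g ∈ J and h ∈ I the Leibniz rule gives fg dh = d(fgh) - hf dg - hg df, and fgh, hf, hg
all lie in I ∩ J. Two factors from J are needed so that one is left after differentiating the other.
-/
lemma sq_smul_relations_le (I J : Ideal (MvPolynomial σ K)) :
    J ^ 2 • relations I ≤ relations (I ⊓ J) := by
  refine Submodule.smul_le.2 fun r hr ω hω => ?_
  rw [pow_two] at hr
  induction hr using Submodule.mul_induction_on' with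
  | mem_mul_mem f hf g hg =>
    induction hω using Submodule.span_induction with
    | mem ω hω =>
      rcases hω with hω | ⟨h, hh, η, rfl⟩
      · refine mem_relations_of_forall_mem fun S => ⟨I.mul_mem_left _ (hω S), ?_⟩
        exact J.mul_mem_right _ (J.mul_mem_right _ hf)
      · have h1 : (f * g) • wedgeDiff h η =
            wedgeDiff (f * g * h) η - ((h * f) • wedgeDiff g η + (h * g) • wedgeDiff f η) := by
          rw [wedgeDiff_mul (f * g) h, wedgeDiff_mul f g, smul_add, smul_smul, smul_smul]
          abel
        rw [h1]
        refine sub_mem (wedgeDiff_mem_relations (Ideal.mem_inf.2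
          ⟨I.mul_mem_left _ hh, ?_⟩) _) (add_mem ?_ ?_)
        · exact J.mul_mem_right _ (J.mul_mem_right _ hf)
        · exact smul_mem_relations (Ideal.mem_inf.2 ⟨I.mul_mem_right _ hh, J.mul_mem_left _ hf⟩) _
        · exact smul_mem_relations (Ideal.mem_inf.2 ⟨I.mul_mem_right _ hh, J.mul_mem_left _ hg⟩) _
    | zero => simp
    | add x y _ _ hx hy => rw [smul_add]; exact add_mem hx hy
    | smul c x _ hx => rw [smul_comm]; exact Submodule.smul_mem _ _ hx
  | add r _ s _ hr hs => rw [add_smul]; exact add_mem hr hs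

lemma mem_smul_top_of_forall_mem {I : Ideal (MvPolynomial σ K)} {ω : Finset σ → MvPolynomial σ K}
    (h : ∀ S, ω S ∈ I) : ω ∈ I • (⊤ : Submodule (MvPolynomial σ K) _) := by
  rw [← Finset.univ_sum_single ω]
  refine sum_mem fun S _ => ?_
  have : (Pi.single S (ω S) : Finset σ → MvPolynomial σ K) = ω S • Pi.single S 1 := by
    simp [← Pi.single_smul]
  rw [this]
  exact Submodule.smul_mem_smul (h S) trivial

omit [LinearOrder σ] [Fintype σ] in
lemma apply_mem_pow_idealOfVars {m i d : ℕ} (hd : d + m ≤ i) {ω : Finset σ → MvPolynomial σ K}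
    (hω : ω ∈ gradedForms K σ m i) (S : Finset σ) : ω S ∈ MvPolynomial.idealOfVars σ K ^ d := by
  rw [MvPolynomial.mem_pow_idealOfVars_iff']
  intro γ hγ
  by_contra h
  have := (hω S γ h).2
  omega

/-- By Artin–Rees, a common relation of large degree is a combination of common relations with
coefficients in a high power of the irrelevant ideal, hence in I² + J². Each summand then falls
under `sq_smul_relations_le`. -/
lemma exists_inf_le_relations_inf {I J : Ideal (MvPolynomial σ K)} {c : ℕ}
    (hc : MvPolynomial.idealOfVars σ K ^ c ≤ I ⊔ J) (m : ℕ) :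
    ∃ i₀, ∀ i, i₀ ≤ i → ∀ ω ∈ gradedForms K σ m i, ω ∈ relations I → ω ∈ relations J →
      ω ∈ relations (I ⊓ J) := by
  obtain ⟨k, hk⟩ := Ideal.exists_pow_inf_eq_pow_smul (MvPolynomial.idealOfVars σ K)
    (relations I ⊓ relations J)
  refine ⟨k + c * 4 + m, fun i hi ω hω hI hJ => ?_⟩
  have h1 : ω ∈ MvPolynomial.idealOfVars σ K ^ (k + c * 4) •
      (⊤ : Submodule (MvPolynomial σ K) _) ⊓ (relations I ⊓ relations J) :=
    ⟨mem_smul_top_of_forall_mem (apply_mem_pow_idealOfVars hi hω), hI, hJ⟩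
  rw [hk _ (by omega), Nat.add_sub_cancel_left] at h1
  -- The factor 4 is 2 + 2: it is the exponent for which (I + J)^4 ⊆ I² + J².
  have h2 : MvPolynomial.idealOfVars σ K ^ (c * 4) ≤ I ^ 2 ⊔ J ^ 2 := by
    rw [pow_mul]
    exact (Ideal.pow_right_mono hc 4).trans (Ideal.sup_pow_add_le_pow_sup_pow (n := 2) (m := 2))
  have h3 : (I ^ 2 ⊔ J ^ 2) • (relations I ⊓ relations J) ≤ relations (I ⊓ J) := by
    rw [Submodule.sup_smul]
    refine sup_le ?_ ?_
    · rw [inf_comm I J]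
      exact (smul_mono_right _ inf_le_right).trans (sq_smul_relations_le J I)
    · exact (smul_mono_right _ inf_le_left).trans (sq_smul_relations_le I J)
  exact h3 (Submodule.smul_mono h2 inf_le_right h1)

/-- An ideal of a polynomial ring is graded if it contains the homogeneous components of its
elements. -/
def IsGradedIdeal (I : Ideal (MvPolynomial σ K)) : Prop :=
  ∀ f ∈ I, ∀ d, MvPolynomial.homogeneousComponent d f ∈ I

/-- In large degree every coefficient lies in I + J. Taking homogeneous components of the two
summands keeps the splitting in the same graded piece. -/
lemma exists_add_eq_of_mem_gradedForms {I J : Ideal (MvPolynomial σ K)} (hI : IsGradedIdeal I)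
    (hJ : IsGradedIdeal J) {c : ℕ} (hc : MvPolynomial.idealOfVars σ K ^ c ≤ I ⊔ J) {m i : ℕ}
    (hi : c + m ≤ i) {ω : Finset σ → MvPolynomial σ K} (hω : ω ∈ gradedForms K σ m i) :
    ∃ ω₁ ∈ gradedForms K σ m i, ∃ ω₂ ∈ gradedForms K σ m i,
      ω₁ ∈ relations I ∧ ω₂ ∈ relations J ∧ ω₁ + ω₂ = ω := by
  have key : ∀ S, ∃ a b, a ∈ I ∧ b ∈ J ∧ a + b = ω S ∧
      (∀ γ, a.coeff γ ≠ 0 → S.card = m ∧ γ.degree + m = i) ∧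
      (∀ γ, b.coeff γ ≠ 0 → S.card = m ∧ γ.degree + m = i) := by
    intro S
    by_cases hS : S.card = m
    · obtain ⟨a, ha, b, hb, hab⟩ := Submodule.mem_sup.1 (hc (apply_mem_pow_idealOfVars hi hω S))
      have hcomp : ∀ f : MvPolynomial σ K, ∀ γ : σ →₀ ℕ,
          (MvPolynomial.homogeneousComponent (i - m) f).coeff γ ≠ 0 →
            S.card = m ∧ γ.degree + m = i := fun f γ h => by
        have := degree_eq_of_coeff_ne_zero
          (MvPolynomial.homogeneousComponent_isHomogeneous (i - m) f) h
        omega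
      refine ⟨_, _, hI a ha (i - m), hJ b hb (i - m), ?_, hcomp a, hcomp b⟩
      rw [← map_add, hab, MvPolynomial.homogeneousComponent_of_mem (m := i - m) ?_, if_pos rfl]
      intro γ h
      have := (hω S γ h).2
      rw [show (Finsupp.weight 1) γ = γ.degree by rw [Finsupp.degree_eq_weight_one]; rfl]
      omega
    · have : ω S = 0 := by
        ext γ
        by_contra h
        exact hS (hω S γ h).1
      exact ⟨0, 0, zero_mem _, zero_mem _, by simp [this], by simp, by simp⟩
  choose a b ha hb hab ha' hb' using key
  exact ⟨a, ha', b, hb', mem_relations_of_forall_mem ha, mem_relations_of_forall_mem hb,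
    funext hab⟩

/-- The subspace of the relations in `gradedForms K σ m i`. -/
noncomputable def gradedRelations (I : Ideal (MvPolynomial σ K)) (m i : ℕ) :
    Submodule K (gradedForms K σ m i) :=
  ((relations I).restrictScalars K).comap (gradedForms K σ m i).subtype

lemma mem_gradedRelations {I : Ideal (MvPolynomial σ K)} {m i : ℕ} {ω : gradedForms K σ m i} :
    ω ∈ gradedRelations I m i ↔ ω.1 ∈ relations I := Iff.rfl

lemma formsHilbert_add_finrank (I : Ideal (MvPolynomial σ K)) (m i : ℕ) :
    formsHilbert I m i + Module.finrank K (gradedRelations I m i) =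
      Module.finrank K (gradedForms K σ m i) := by
  have h := LinearMap.finrank_range_add_finrank_ker
    (((relations I).mkQ.restrictScalars K).domRestrict (gradedForms K σ m i))
  rw [LinearMap.range_domRestrict] at h
  have h2 : gradedRelations I m i =
      LinearMap.ker (((relations I).mkQ.restrictScalars K).domRestrict (gradedForms K σ m i)) := by
    ext ω
    simp [mem_gradedRelations]
  rw [h2]
  exact h

/-- Grassmann's dimension formula for the two spaces of relations, whose sum is the whole graded
piece and whose intersection is the space of relations of I ∩ J. -/
lemma exists_formsHilbert_inf {I J : Ideal (MvPolynomial σ K)} (hI : IsGradedIdeal I)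
    (hJ : IsGradedIdeal J) {c : ℕ} (hc : MvPolynomial.idealOfVars σ K ^ c ≤ I ⊔ J) (m : ℕ) :
    ∃ i₀, ∀ i, i₀ ≤ i → formsHilbert (I ⊓ J) m i = formsHilbert I m i + formsHilbert J m i := by
  obtain ⟨i₀, hi₀⟩ := exists_inf_le_relations_inf hc m
  refine ⟨max i₀ (c + m), fun i hi => ?_⟩
  have h1 : gradedRelations (I ⊓ J) m i = gradedRelations I m i ⊓ gradedRelations J m i := by
    ext ω
    refine ⟨fun h => ⟨relations_mono inf_le_left h, relations_mono inf_le_right h⟩, fun h => ?_⟩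
    exact hi₀ i (le_of_max_le_left hi) ω.1 ω.2 h.1 h.2
  have h2 : gradedRelations I m i ⊔ gradedRelations J m i = ⊤ := by
    refine eq_top_iff.2 fun ω _ => ?_
    obtain ⟨ω₁, h₁, ω₂, h₂, hr₁, hr₂, h⟩ :=
      exists_add_eq_of_mem_gradedForms hI hJ hc (le_of_max_le_right hi) ω.2
    exact Submodule.mem_sup.2 ⟨⟨ω₁, h₁⟩, hr₁, ⟨ω₂, h₂⟩, hr₂, Subtype.ext h⟩
  have h3 := Submodule.finrank_sup_add_finrank_inf_eq (gradedRelations I m i)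
    (gradedRelations J m i)
  rw [h2, ← h1, finrank_top] at h3
  have := formsHilbert_add_finrank I m i
  have := formsHilbert_add_finrank J m i
  have := formsHilbert_add_finrank (I ⊓ J) m i
  omega

lemma formsHilbert_top (m i : ℕ) : formsHilbert (⊤ : Ideal (MvPolynomial σ K)) m i = 0 := by
  have h := formsHilbert_add_finrank (⊤ : Ideal (MvPolynomial σ K)) m i
  have : gradedRelations (⊤ : Ideal (MvPolynomial σ K)) m i = ⊤ :=
    eq_top_iff.2 fun ω _ => mem_relations_of_forall_mem fun S => trivial
  rw [this, finrank_top] at h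
  omega

/-- In (a + b)(c + d) with a, c ∈ I, every product except bd lies in I, and bd lies in both J and L.
-/
lemma sup_mul_sup_le {R : Type*} [CommRing R] (I J L : Ideal R) :
    (I ⊔ J) * (I ⊔ L) ≤ I ⊔ J ⊓ L := by
  refine Ideal.mul_le.2 fun r hr s hs => ?_
  obtain ⟨a, ha, b, hb, rfl⟩ := Submodule.mem_sup.1 hr
  obtain ⟨c, hc, d, hd, rfl⟩ := Submodule.mem_sup.1 hs
  refine Submodule.mem_sup.2 ⟨a * (c + d) + b * c, ?_, b * d, ?_, by ring⟩
  · exact add_mem (I.mul_mem_right _ ha) (I.mul_mem_left _ hc)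
  · exact ⟨J.mul_mem_right _ hb, L.mul_mem_left _ hd⟩

omit [LinearOrder σ] [Fintype σ] in
lemma exists_pow_le_sup_finset_inf {ι : Type*} {A : Ideal (MvPolynomial σ K)}
    (I : ι → Ideal (MvPolynomial σ K)) (s : Finset ι)
    (h : ∀ j ∈ s, ∃ c, MvPolynomial.idealOfVars σ K ^ c ≤ A ⊔ I j) :
    ∃ c, MvPolynomial.idealOfVars σ K ^ c ≤ A ⊔ s.inf I := by
  classical
  induction s using Finset.induction_on with
  | empty => exact ⟨0, by simp⟩
  | insert a s ha ih =>
    obtain ⟨c, hc⟩ := ih fun j hj => h j (Finset.mem_insert_of_mem hj)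
    obtain ⟨d, hd⟩ := h a (Finset.mem_insert_self _ _)
    refine ⟨d + c, ?_⟩
    rw [pow_add, Finset.inf_insert]
    exact (Ideal.mul_mono hd hc).trans (sup_mul_sup_le _ _ _)

omit [LinearOrder σ] [Fintype σ] in
lemma IsGradedIdeal.finset_inf {ι : Type*} {I : ι → Ideal (MvPolynomial σ K)}
    (hI : ∀ j, IsGradedIdeal (I j)) (s : Finset ι) : IsGradedIdeal (s.inf I) := by
  intro f hf d
  rw [Submodule.mem_finsetInf] at hf ⊢
  exact fun j hj => hI j f (hf j hj) d

lemma exists_formsHilbert_finset_inf {ι : Type*} {I : ι → Ideal (MvPolynomial σ K)}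
    (hI : ∀ j, IsGradedIdeal (I j))
    (h : ∀ j l, j ≠ l → ∃ c, MvPolynomial.idealOfVars σ K ^ c ≤ I j ⊔ I l) (m : ℕ)
    (s : Finset ι) :
    ∃ i₀, ∀ i, i₀ ≤ i → formsHilbert (s.inf I) m i = ∑ j ∈ s, formsHilbert (I j) m i := by
  classical
  induction s using Finset.induction_on with
  | empty => exact ⟨0, fun i _ => by simp [formsHilbert_top]⟩
  | insert a s ha ih =>
    obtain ⟨i₀, hi₀⟩ := ih
    obtain ⟨c, hc⟩ := exists_pow_le_sup_finset_inf (A := I a) I s fun j hj =>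
      h a j (by rintro rfl; exact ha hj)
    obtain ⟨i₁, hi₁⟩ := exists_formsHilbert_inf (hI a) (.finset_inf hI s) hc m
    refine ⟨max i₀ i₁, fun i hi => ?_⟩
    rw [Finset.inf_insert, hi₁ i (le_of_max_le_right hi), hi₀ i (le_of_max_le_left hi),
      Finset.sum_insert ha]

end Gluing

/-! ### Point ideals and reduction to the point (1 : 0 : ⋯ : 0). -/

variable {K : Type*} [Field K] {n : ℕ}

lemma isGradedIdeal_pointIdeal_pow (p : ℙ K (Fin (n + 1) → K)) (k : ℕ) :
    IsGradedIdeal (pointIdeal p ^ k) := by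
  let _ := MvPolynomial.gradedAlgebra (σ := Fin (n + 1)) (R := K)
  have h1 : (pointIdeal p).IsHomogeneous (MvPolynomial.homogeneousSubmodule (Fin (n + 1)) K) :=
    Ideal.homogeneous_span _ _ fun f hf => hf.1
  have h : (pointIdeal p ^ k).IsHomogeneous
      (MvPolynomial.homogeneousSubmodule (Fin (n + 1)) K) := by
    induction k with
    | zero => rw [pow_zero, Ideal.one_eq_top]; exact Ideal.IsHomogeneous.top _
    | succ k ih => rw [pow_succ]; exact ih.mul h1
  exact fun f hf d => MvPolynomial.homogeneousComponent_mem_of_mem h hf d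

lemma linear_mem_pointIdeal {p : ℙ K (Fin (n + 1) → K)} {f : MvPolynomial (Fin (n + 1)) K}
    (h : f.IsHomogeneous 1) (h0 : MvPolynomial.eval p.rep f = 0) : f ∈ pointIdeal p :=
  Ideal.subset_span ⟨⟨1, h⟩, h0⟩

lemma exists_linear_form_of_ne {p q : ℙ K (Fin (n + 1) → K)} (hpq : p ≠ q) :
    ∃ l : MvPolynomial (Fin (n + 1)) K, l.IsHomogeneous 1 ∧ MvPolynomial.eval p.rep l = 0 ∧
      MvPolynomial.eval q.rep l ≠ 0 := by
  obtain ⟨j, hj⟩ := Function.ne_iff.1 p.rep_nonzero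
  by_contra! hcon
  apply hpq
  -- The linear forms p_j X_i - p_i X_j vanish at p. If they all vanish at q, then q is proportional
  -- to p.
  have h : ∀ i, q.rep i * p.rep j = p.rep i * q.rep j := fun i => by
    have := hcon (MvPolynomial.C (p.rep j) * MvPolynomial.X i -
      MvPolynomial.C (p.rep i) * MvPolynomial.X j)
      ((MvPolynomial.isHomogeneous_C_mul_X _ _).sub (MvPolynomial.isHomogeneous_C_mul_X _ _))
      (by simp [mul_comm])
    simp only [map_sub, map_mul, MvPolynomial.eval_C, MvPolynomial.eval_X] at this
    linear_combination this
  rw [← p.mk_rep, ← q.mk_rep, eq_comm, Projectivization.mk_eq_mk_iff']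
  refine ⟨q.rep j / p.rep j, funext fun i => ?_⟩
  simp only [Pi.zero_apply] at hj
  rw [Pi.smul_apply, smul_eq_mul]
  field_simp
  linear_combination -h i

lemma idealOfVars_le_sup_pointIdeal {p q : ℙ K (Fin (n + 1) → K)} (hpq : p ≠ q) :
    MvPolynomial.idealOfVars (Fin (n + 1)) K ≤ pointIdeal p ⊔ pointIdeal q := by
  obtain ⟨l, hl, hp, hq⟩ := exists_linear_form_of_ne hpq
  rw [Ideal.span_le]
  rintro _ ⟨i, rfl⟩
  -- The scalar for which X_i - c l vanishes at q, where l vanishes at p only.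
  set c := q.rep i / MvPolynomial.eval q.rep l
  have h1 : MvPolynomial.C c * l ∈ pointIdeal p := (pointIdeal p).mul_mem_left _
    (linear_mem_pointIdeal hl hp)
  have h2 : MvPolynomial.X i - MvPolynomial.C c * l ∈ pointIdeal q := by
    refine linear_mem_pointIdeal ((MvPolynomial.isHomogeneous_X K i).sub (hl.C_mul c)) ?_
    simp [c, hq]
  exact Submodule.mem_sup.2 ⟨_, h1, _, h2, by ring⟩

lemma exists_pow_le_sup_pointIdeal_pow {p q : ℙ K (Fin (n + 1) → K)} (hpq : p ≠ q) (a b : ℕ) :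
    ∃ c, MvPolynomial.idealOfVars (Fin (n + 1)) K ^ c ≤ pointIdeal p ^ a ⊔ pointIdeal q ^ b :=
  ⟨a + b, (Ideal.pow_right_mono (idealOfVars_le_sup_pointIdeal hpq) _).trans
    Ideal.sup_pow_add_le_pow_sup_pow⟩

/-- The ideal of the point `(1 : 0 : ⋯ : 0)`. -/
noncomputable def originIdeal (K : Type*) [Field K] (n : ℕ) :
    Ideal (MvPolynomial (Fin (n + 1)) K) :=
  Ideal.span (MvPolynomial.X '' {i | i ≠ 0})

/-- The only monomial of degree d outside the ideal is X_0^d, and its coefficient is the value at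
(c, 0, …, 0) divided by c^d. -/
lemma mem_originIdeal_of_eval_eq_zero {f : MvPolynomial (Fin (n + 1)) K} {d : ℕ}
    (hf : f.IsHomogeneous d) {c : K} (hc : c ≠ 0)
    (h : MvPolynomial.eval (Pi.single 0 c) f = 0) : f ∈ originIdeal K n := by
  rw [originIdeal, MvPolynomial.mem_ideal_span_X_image]
  intro γ hγ
  by_contra! hcon
  have h0 : ∀ δ : Fin (n + 1) →₀ ℕ, f.coeff δ ≠ 0 → (∀ i, i ≠ 0 → δ i = 0) →
      δ = Finsupp.single 0 d := fun δ hδ hi => by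
    have := degree_eq_of_coeff_ne_zero hf hδ
    rw [Finsupp.degree_eq_sum, Fin.sum_univ_succ] at this
    ext j
    by_cases hj : j = 0
    · subst hj
      simpa [hi _ (Fin.succ_ne_zero _)] using this
    · rw [hi j hj, Finsupp.single_eq_of_ne hj]
  have hγ' := MvPolynomial.mem_support_iff.1 hγ
  have hγ0 := h0 γ hγ' hcon
  rw [MvPolynomial.eval_eq', Finset.sum_eq_single γ] at h
  · rcases mul_eq_zero.1 h with h | h
    · exact hγ' h
    · rw [Finset.prod_eq_zero_iff] at h
      obtain ⟨i, _, hi⟩ := h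
      by_cases hi0 : i = 0
      · subst hi0
        simp [hc] at hi
      · rw [hcon i hi0] at hi
        simp at hi
  · intro δ hδ hne
    have : ∃ i, i ≠ 0 ∧ δ i ≠ 0 := by
      by_contra! hall
      exact hne ((h0 δ (MvPolynomial.mem_support_iff.1 hδ) hall).trans hγ0.symm)
    obtain ⟨i, hi, hδi⟩ := this
    refine mul_eq_zero_of_right _ (Finset.prod_eq_zero (Finset.mem_univ i) ?_)
    simp [hi, hδi]
  · exact fun h => absurd hγ h

/-- The linear change of coordinates which exchanges the variables `0` and `j` and subtracts
`a i • X j` from the image of the variable `i`. -/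
noncomputable def coordinateChange (j : Fin (n + 1)) (a : Fin (n + 1) → K) (ha : a 0 = 0) :
    MvPolynomial (Fin (n + 1)) K ≃ₐ[K] MvPolynomial (Fin (n + 1)) K :=
  AlgEquiv.ofAlgHom
    (MvPolynomial.aeval fun i => MvPolynomial.X (Equiv.swap 0 j i) -
      MvPolynomial.C (a i) * MvPolynomial.X j)
    (MvPolynomial.aeval fun i => MvPolynomial.X (Equiv.swap 0 j i) +
      MvPolynomial.C (a (Equiv.swap 0 j i)) * MvPolynomial.X 0)
    (by
      refine MvPolynomial.algHom_ext fun i => ?_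
      simp [ha, MvPolynomial.algHom_C])
    (by
      refine MvPolynomial.algHom_ext fun i => ?_
      simp [ha, MvPolynomial.algHom_C])

lemma coordinateChange_apply (j : Fin (n + 1)) (a : Fin (n + 1) → K) (ha : a 0 = 0)
    (f : MvPolynomial (Fin (n + 1)) K) : coordinateChange j a ha f =
      MvPolynomial.aeval (fun i => MvPolynomial.X (Equiv.swap 0 j i) -
        MvPolynomial.C (a i) * MvPolynomial.X j) f := rfl

lemma coordinateChange_isHomogeneous (j : Fin (n + 1)) (a : Fin (n + 1) → K) (ha : a 0 = 0)
    (f : MvPolynomial (Fin (n + 1)) K) (d : ℕ) (hf : f.IsHomogeneous d) :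
    (coordinateChange j a ha f).IsHomogeneous d := by
  have := hf.aeval (n := 1) (fun i => MvPolynomial.X (Equiv.swap 0 j i) -
      MvPolynomial.C (a i) * MvPolynomial.X j) fun i =>
    (MvPolynomial.isHomogeneous_X K _).sub (MvPolynomial.isHomogeneous_C_mul_X _ _)
  rwa [one_mul] at this

lemma coordinateChange_symm_isHomogeneous (j : Fin (n + 1)) (a : Fin (n + 1) → K) (ha : a 0 = 0)
    (f : MvPolynomial (Fin (n + 1)) K) (d : ℕ) (hf : f.IsHomogeneous d) :
    ((coordinateChange j a ha).symm f).IsHomogeneous d := by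
  have := hf.aeval (n := 1) (fun i => MvPolynomial.X (Equiv.swap 0 j i) +
      MvPolynomial.C (a (Equiv.swap 0 j i)) * MvPolynomial.X 0) fun i =>
    (MvPolynomial.isHomogeneous_X K _).add (MvPolynomial.isHomogeneous_C_mul_X _ _)
  rwa [one_mul] at this

lemma exists_comap_pointIdeal_eq (p : ℙ K (Fin (n + 1) → K)) :
    ∃ (j : Fin (n + 1)) (a : Fin (n + 1) → K) (ha : a 0 = 0),
      (pointIdeal p).comap (coordinateChange j a ha) = originIdeal K n := by
  obtain ⟨j, hj⟩ := Function.ne_iff.1 p.rep_nonzero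
  rw [Pi.zero_apply] at hj
  -- With p_j ≠ 0, these constants make the image of X_i vanish at p for every i ≠ 0, while X_0 goes
  -- to X_j.
  refine ⟨j, fun i => if i = 0 then 0 else p.rep (Equiv.swap 0 j i) / p.rep j, if_pos rfl, ?_⟩
  set a : Fin (n + 1) → K := fun i => if i = 0 then 0 else p.rep (Equiv.swap 0 j i) / p.rep j
  have ha : a 0 = 0 := if_pos rfl
  have heval : ∀ f, MvPolynomial.eval p.rep (coordinateChange j a ha f) =
      MvPolynomial.eval (Pi.single 0 (p.rep j)) f := fun f => by
    rw [coordinateChange_apply]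
    induction f using MvPolynomial.induction_on with
    | C c => simp [MvPolynomial.algHom_C]
    | add f g hf hg => rw [map_add, map_add, map_add, hf, hg]
    | mul_X f i hf =>
      rw [map_mul, map_mul, map_mul, hf]
      congr 1
      by_cases hi : i = 0
      · subst hi; simp [a]
      · simp [a, hi, hj]
  apply le_antisymm
  · intro f hf
    have h : pointIdeal p ≤ (originIdeal K n).comap (coordinateChange j a ha).symm := by
      refine Ideal.span_le.2 ?_
      rintro g ⟨⟨d, hg⟩, h0⟩
      refine mem_originIdeal_of_eval_eq_zero (coordinateChange_symm_isHomogeneous j a ha g d hg)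
        hj ?_
      rw [← heval, AlgEquiv.apply_symm_apply, h0]
    have := h hf
    rwa [Ideal.mem_comap, AlgEquiv.symm_apply_apply] at this
  · refine Ideal.span_le.2 ?_
    rintro _ ⟨i, hi, rfl⟩
    refine linear_mem_pointIdeal (coordinateChange_isHomogeneous j a ha _ 1
      (MvPolynomial.isHomogeneous_X K i)) ?_
    rw [heval, MvPolynomial.eval_X, Pi.single_eq_of_ne hi]

lemma formsHilbert_pointIdeal_pow (p : ℙ K (Fin (n + 1) → K)) (k m i : ℕ) :
    formsHilbert (pointIdeal p ^ k) m i = formsHilbert (originIdeal K n ^ k) m i := by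
  obtain ⟨j, a, ha, h⟩ := exists_comap_pointIdeal_eq p
  rw [← formsHilbert_comap (coordinateChange j a ha) (coordinateChange_isHomogeneous j a ha)
    (coordinateChange_symm_isHomogeneous j a ha)]
  congr 1
  have h1 : pointIdeal p = (originIdeal K n).map (coordinateChange j a ha) := by
    rw [← h, Ideal.map_comap_of_surjective _ (coordinateChange j a ha).surjective]
  rw [h1, ← Ideal.map_pow, Ideal.comap_map_of_bijective _ (coordinateChange j a ha).bijective]

lemma fatPointIdeal_eq_inf {t : ℕ} (p : Fin t → ℙ K (Fin (n + 1) → K)) (mult : Fin t → ℕ) :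
    fatPointIdeal p mult = Finset.univ.inf fun i => pointIdeal (p i) ^ mult i := by
  rw [fatPointIdeal, Finset.inf_univ_eq_iInf]

lemma exists_formsHilbert_fatPointIdeal {t : ℕ} {p : Fin t → ℙ K (Fin (n + 1) → K)}
    (hp : Function.Injective p) (mult : Fin t → ℕ) (m : ℕ) :
    ∃ i₀, ∀ i, i₀ ≤ i → formsHilbert (fatPointIdeal p mult) m i =
      ∑ j, formsHilbert (originIdeal K n ^ mult j) m i := by
  obtain ⟨i₀, h⟩ := exists_formsHilbert_finset_inf
    (fun j => isGradedIdeal_pointIdeal_pow (p j) (mult j))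
    (fun j l hjl => exists_pow_le_sup_pointIdeal_pow (hp.ne hjl) _ _) m Finset.univ
  refine ⟨i₀, fun i hi => ?_⟩
  rw [fatPointIdeal_eq_inf, h i hi]
  simp only [formsHilbert_pointIdeal_pow]

/-! ### The exterior derivative on polynomial forms. -/

section ExteriorDerivative

variable {K : Type*} [Field K] {σ : Type*} [LinearOrder σ] [Fintype σ]

/-- The partial derivative of a form, coefficient by coefficient. -/
noncomputable def pderivForm (i : σ) :
    (Finset σ → MvPolynomial σ K) →ₗ[K] (Finset σ → MvPolynomial σ K) :=
  LinearMap.pi fun S => (MvPolynomial.pderiv i).toLinearMap ∘ₗ LinearMap.proj S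

omit [LinearOrder σ] [Fintype σ] in
lemma pderivForm_apply (i : σ) (ω : Finset σ → MvPolynomial σ K) (S : Finset σ) :
    pderivForm i ω S = MvPolynomial.pderiv i (ω S) := rfl

omit [LinearOrder σ] [Fintype σ] in
lemma pderivForm_smul (i : σ) (f : MvPolynomial σ K) (ω : Finset σ → MvPolynomial σ K) :
    pderivForm i (f • ω) = f • pderivForm i ω + MvPolynomial.pderiv i f • ω := by
  ext1 S
  simp [pderivForm_apply, Derivation.leibniz, mul_comm]

omit [Fintype σ] in
lemma pderivForm_wedgeVar (i j : σ) (ω : Finset σ → MvPolynomial σ K) :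
    pderivForm i (wedgeVar _ j ω) = wedgeVar _ j (pderivForm i ω) := by
  ext1 S
  rw [pderivForm_apply, wedgeVar_apply, wedgeVar_apply]
  split_ifs
  · simp [pderivForm_apply, Derivation.leibniz]
  · simp

omit [Fintype σ] in
lemma pderiv_comm (i j : σ) (f : MvPolynomial σ K) :
    MvPolynomial.pderiv i (MvPolynomial.pderiv j f) =
      MvPolynomial.pderiv j (MvPolynomial.pderiv i f) := by
  ext γ
  simp only [MvPolynomial.coeff_pderiv]
  rw [add_right_comm]
  by_cases h : i = j
  · subst h; rfl
  · simp [h, Ne.symm h]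
    ring

/-- The exterior derivative of a form with polynomial coefficients. -/
noncomputable def extDeriv :
    (Finset σ → MvPolynomial σ K) →ₗ[K] (Finset σ → MvPolynomial σ K) :=
  ∑ i, (wedgeVar (MvPolynomial σ K) i).restrictScalars K ∘ₗ pderivForm i

lemma extDeriv_apply (ω : Finset σ → MvPolynomial σ K) :
    extDeriv ω = ∑ i, wedgeVar _ i (pderivForm i ω) := by
  simp [extDeriv, LinearMap.sum_apply]

lemma wedgeDiff_apply (f : MvPolynomial σ K) (ω : Finset σ → MvPolynomial σ K) :
    wedgeDiff f ω = ∑ i, MvPolynomial.pderiv i f • wedgeVar _ i ω :=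
  wedgeVec_apply _ _

lemma extDeriv_smul (f : MvPolynomial σ K) (ω : Finset σ → MvPolynomial σ K) :
    extDeriv (f • ω) = f • extDeriv ω + wedgeDiff f ω := by
  simp only [extDeriv_apply, wedgeDiff_apply, pderivForm_smul, map_add, map_smul,
    Finset.sum_add_distrib, Finset.smul_sum]

/-- This is d(df ∧ ω) = -df ∧ dω: the second derivatives of f are symmetric and drop out by
`sum_sum_smul_wedgeVar`. -/
lemma extDeriv_wedgeDiff (f : MvPolynomial σ K) (ω : Finset σ → MvPolynomial σ K) :
    extDeriv (wedgeDiff f ω) = -wedgeDiff f (extDeriv ω) := by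
  have h : ∑ j, ∑ i, MvPolynomial.pderiv i (MvPolynomial.pderiv j f) •
      wedgeVar _ i (wedgeVar _ j ω) = 0 := by
    rw [Finset.sum_comm]
    exact sum_sum_smul_wedgeVar
      (c := fun i j => MvPolynomial.pderiv i (MvPolynomial.pderiv j f))
      (fun i j => pderiv_comm i j f) ω
  have h1 : extDeriv (wedgeDiff f ω) =
      ∑ j, ∑ i, MvPolynomial.pderiv j f • wedgeVar _ i (wedgeVar _ j (pderivForm i ω)) +
      ∑ j, ∑ i, MvPolynomial.pderiv i (MvPolynomial.pderiv j f) •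
        wedgeVar _ i (wedgeVar _ j ω) := by
    simp only [extDeriv_apply, wedgeDiff_apply, map_sum, pderivForm_smul, map_add, map_smul,
      pderivForm_wedgeVar, Finset.sum_add_distrib]
  rw [h1, h, add_zero, wedgeDiff_apply, ← Finset.sum_neg_distrib]
  refine Finset.sum_congr rfl fun j _ => ?_
  rw [extDeriv_apply, map_sum, Finset.smul_sum, ← Finset.sum_neg_distrib]
  refine Finset.sum_congr rfl fun i _ => ?_
  rw [wedgeVar_anticomm, smul_neg]

lemma coeff_extDeriv (ω : Finset σ → MvPolynomial σ K) (T : Finset σ) (δ : σ →₀ ℕ) :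
    (extDeriv ω T).coeff δ = ∑ i ∈ T, (shuffleSign i T : K) *
      ((ω (T.erase i)).coeff (δ + Finsupp.single i 1) * (δ i + 1)) := by
  rw [extDeriv_apply, Finset.sum_apply, MvPolynomial.coeff_sum]
  simp only [wedgeVar_apply]
  rw [← Finset.sum_subset (Finset.subset_univ T)]
  · refine Finset.sum_congr rfl fun i hi => ?_
    rw [if_pos hi, coeff_intCast_mul, pderivForm_apply, MvPolynomial.coeff_pderiv]
  · intro i _ hi
    rw [if_neg hi, MvPolynomial.coeff_zero]

end ExteriorDerivative

/-! ### A monomial basis of the forms modulo the relations of a power of (X_1, …, X_n). -/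

section OriginIdeal

variable {K : Type*} [Field K] {n : ℕ}

/-- The degree of a monomial in the variables other than the first one. -/
def tailDegree (γ : Fin (n + 1) →₀ ℕ) : ℕ := ∑ i : Fin n, γ i.succ

lemma tailDegree_add (γ δ : Fin (n + 1) →₀ ℕ) :
    tailDegree (γ + δ) = tailDegree γ + tailDegree δ := by
  simp [tailDegree, Finset.sum_add_distrib]

lemma tailDegree_single_zero (a : ℕ) : tailDegree (Finsupp.single (0 : Fin (n + 1)) a) = 0 := by
  simp [tailDegree]

lemma tailDegree_single_of_ne {i : Fin (n + 1)} (hi : i ≠ 0) (a : ℕ) :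
    tailDegree (Finsupp.single i a) = a := by
  obtain ⟨j, rfl⟩ := Fin.exists_succ_eq.2 hi
  simp [tailDegree, Finsupp.single_apply]

lemma apply_le_tailDegree {i : Fin (n + 1)} (hi : i ≠ 0) (γ : Fin (n + 1) →₀ ℕ) :
    γ i ≤ tailDegree γ := by
  obtain ⟨j, rfl⟩ := Fin.exists_succ_eq.2 hi
  exact Finset.single_le_sum (f := fun j : Fin n => γ j.succ) (fun _ _ => Nat.zero_le _)
    (Finset.mem_univ j)

lemma exists_of_tailDegree_ne_zero {γ : Fin (n + 1) →₀ ℕ} (h : tailDegree γ ≠ 0) :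
    ∃ i, i ≠ 0 ∧ γ i ≠ 0 := by
  obtain ⟨j, _, hj⟩ := Finset.exists_ne_zero_of_sum_ne_zero h
  exact ⟨j.succ, Fin.succ_ne_zero j, hj⟩

lemma exists_eq_add_single {σ : Type*} {γ : σ →₀ ℕ} {i : σ} (h : γ i ≠ 0) :
    ∃ δ, γ = δ + Finsupp.single i 1 :=
  ⟨γ - Finsupp.single i 1, (tsub_add_cancel_of_le
    (Finsupp.single_le_iff.2 (Nat.one_le_iff_ne_zero.2 h))).symm⟩

lemma le_tailDegree_of_mem {k : ℕ} {f : MvPolynomial (Fin (n + 1)) K}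
    (hf : f ∈ originIdeal K n ^ k) {γ : Fin (n + 1) →₀ ℕ} (h : f.coeff γ ≠ 0) :
    k ≤ tailDegree γ := by
  induction k generalizing f γ with
  | zero => exact Nat.zero_le _
  | succ k ih =>
    rw [pow_succ] at hf
    induction hf using Submodule.mul_induction_on' generalizing γ with
    | mem_mul_mem f hf g hg =>
      obtain ⟨α, β, rfl, hα, hβ⟩ := exists_coeff_ne_zero_of_mul h
      obtain ⟨i, hi, hi'⟩ := MvPolynomial.mem_ideal_span_X_image.1 hg β
        (MvPolynomial.mem_support_iff.2 hβ)
      have h1 := ih hf hα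
      have h2 := apply_le_tailDegree hi β
      rw [tailDegree_add]
      omega
    | add f _ g _ hf hg =>
      by_cases h1 : f.coeff γ = 0
      · exact hg fun h2 => h (by simp [h1, h2])
      · exact hf h1

lemma monomial_mem_originIdeal_pow {k : ℕ} {γ : Fin (n + 1) →₀ ℕ} (h : k ≤ tailDegree γ) (c : K) :
    MvPolynomial.monomial γ c ∈ originIdeal K n ^ k := by
  induction k generalizing γ with
  | zero => simp
  | succ k ih =>
    obtain ⟨i, hi, hγ⟩ := exists_of_tailDegree_ne_zero (γ := γ) (by omega)
    obtain ⟨δ, rfl⟩ := exists_eq_add_single hγ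
    rw [tailDegree_add, tailDegree_single_of_ne hi] at h
    rw [MvPolynomial.monomial_add_single, pow_one, pow_succ]
    exact Ideal.mul_mem_mul (ih (by omega)) (Ideal.subset_span ⟨i, hi, rfl⟩)

lemma coeff_wedgeVar_ne_zero {i : Fin (n + 1)} {f : MvPolynomial (Fin (n + 1)) K}
    {ω : Finset (Fin (n + 1)) → MvPolynomial (Fin (n + 1)) K} {S : Finset (Fin (n + 1))}
    {γ : Fin (n + 1) →₀ ℕ} (h : ((f • wedgeVar _ i ω) S).coeff γ ≠ 0) :
    i ∈ S ∧ ∃ α β, α + β = γ ∧ f.coeff α ≠ 0 ∧ (ω (S.erase i)).coeff β ≠ 0 := by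
  rw [Pi.smul_apply, wedgeVar_apply, smul_eq_mul] at h
  split_ifs at h with hi
  · rw [mul_left_comm, coeff_intCast_mul] at h
    exact ⟨hi, exists_coeff_ne_zero_of_mul (right_ne_zero_of_mul h)⟩
  · simp at h

lemma exists_coeff_ne_zero_of_sum {ι : Type*} {s : Finset ι}
    {ω : ι → Finset (Fin (n + 1)) → MvPolynomial (Fin (n + 1)) K} {S : Finset (Fin (n + 1))}
    {γ : Fin (n + 1) →₀ ℕ} (h : ((∑ i ∈ s, ω i) S).coeff γ ≠ 0) :
    ∃ i ∈ s, (ω i S).coeff γ ≠ 0 := by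
  rw [Finset.sum_apply, MvPolynomial.coeff_sum] at h
  exact Finset.exists_ne_zero_of_sum_ne_zero h

/-- Differentiating an element of the ideal lowers the tail degree only for ∂_i with i ≠ 0, and then
dX_i occurs in the form. So a loss of one is possible only if S ⊄ {0}. -/
lemma le_of_mem_relations {k : ℕ} {ω : Finset (Fin (n + 1)) → MvPolynomial (Fin (n + 1)) K}
    (hω : ω ∈ relations (originIdeal K n ^ k)) {S : Finset (Fin (n + 1))}
    {γ : Fin (n + 1) →₀ ℕ} (h : (ω S).coeff γ ≠ 0) :
    k ≤ tailDegree γ + if S ⊆ {0} then 0 else 1 := by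
  induction hω using Submodule.span_induction generalizing S γ with
  | mem ω hω =>
    rcases hω with hω | ⟨f, hf, η, rfl⟩
    · exact (le_tailDegree_of_mem (hω S) h).trans (Nat.le_add_right _ _)
    · rw [wedgeDiff_apply] at h
      obtain ⟨i, _, h⟩ := exists_coeff_ne_zero_of_sum h
      obtain ⟨hi, α, β, rfl, hα, _⟩ := coeff_wedgeVar_ne_zero h
      have h1 := le_tailDegree_of_mem hf (coeff_pderiv_ne_zero hα)
      rw [tailDegree_add] at h1 ⊢
      by_cases hi0 : i = 0
      · subst hi0
        rw [tailDegree_single_zero] at h1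
        omega
      · rw [tailDegree_single_of_ne hi0] at h1
        rw [if_neg fun hS => hi0 (Finset.mem_singleton.1 (hS hi))]
        omega
  | zero => simp at h
  | add ω η _ _ hω hη =>
    by_cases h1 : (ω S).coeff γ = 0
    · exact hη fun h2 => h (by simp [h1, h2])
    · exact hω h1
  | smul f ω _ hω =>
    obtain ⟨α, β, rfl, _, hβ⟩ := exists_coeff_ne_zero_of_mul h
    have := hω hβ
    rw [tailDegree_add]
    omega

lemma le_succ_of_mem_relations {k : ℕ}
    {ω : Finset (Fin (n + 1)) → MvPolynomial (Fin (n + 1)) K}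
    (hω : ω ∈ relations (originIdeal K n ^ k)) {S : Finset (Fin (n + 1))}
    {γ : Fin (n + 1) →₀ ℕ} (h : (ω S).coeff γ ≠ 0) : k ≤ tailDegree γ + 1 := by
  have := le_of_mem_relations hω h
  split_ifs at this <;> omega

/-- The derivative of a form of tail degree k - 1 generally reaches k - 2, but for relations it does
not: d(df ∧ η) = -df ∧ dη is again a relation, and in d(fω) = f dω + df ∧ ω the last term involves ω
undifferentiated. -/
lemma le_of_extDeriv_of_mem_relations {k : ℕ}
    {ω : Finset (Fin (n + 1)) → MvPolynomial (Fin (n + 1)) K}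
    (hω : ω ∈ relations (originIdeal K n ^ k)) {S : Finset (Fin (n + 1))}
    {γ : Fin (n + 1) →₀ ℕ} (h : (extDeriv ω S).coeff γ ≠ 0) : k ≤ tailDegree γ + 1 := by
  induction hω using Submodule.span_induction generalizing S γ with
  | mem ω hω =>
    rcases hω with hω | ⟨f, hf, η, rfl⟩
    · rw [coeff_extDeriv] at h
      obtain ⟨i, _, h⟩ := Finset.exists_ne_zero_of_sum_ne_zero h
      have h1 := le_tailDegree_of_mem (hω _) (left_ne_zero_of_mul (right_ne_zero_of_mul h))
      rw [tailDegree_add] at h1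
      by_cases hi0 : i = 0
      · subst hi0
        rw [tailDegree_single_zero] at h1
        omega
      · rw [tailDegree_single_of_ne hi0] at h1
        omega
    · rw [extDeriv_wedgeDiff] at h
      exact le_succ_of_mem_relations (neg_mem (wedgeDiff_mem_relations hf _)) h
  | zero => simp at h
  | add ω η _ _ hω hη =>
    by_cases h1 : (extDeriv ω S).coeff γ = 0
    · exact hη (S := S) fun h2 => h (by
        rw [map_add, Pi.add_apply, MvPolynomial.coeff_add, h1, h2, add_zero])
    · exact hω h1
  | smul f ω hω ih =>
    rw [extDeriv_smul] at h
    by_cases h1 : ((f • extDeriv ω) S).coeff γ = 0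
    · have h2 : (wedgeDiff f ω S).coeff γ ≠ 0 := fun h2 => h (by
        rw [Pi.add_apply, MvPolynomial.coeff_add, h1, h2, add_zero])
      rw [wedgeDiff_apply] at h2
      obtain ⟨i, _, h2⟩ := exists_coeff_ne_zero_of_sum h2
      obtain ⟨_, α, β, rfl, _, hβ⟩ := coeff_wedgeVar_ne_zero h2
      have := le_succ_of_mem_relations hω hβ
      rw [tailDegree_add]
      omega
    · obtain ⟨α, β, rfl, _, hβ⟩ := exists_coeff_ne_zero_of_mul h1
      have := ih hβ
      rw [tailDegree_add]
      omega

/-- The indices of the monomial forms which are a basis modulo the relations of the `k`-th power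
of `originIdeal K n`. -/
def IsNormal (k : ℕ) (b : Finset (Fin (n + 1)) × (Fin (n + 1) →₀ ℕ)) : Prop :=
  tailDegree b.2 + 1 < k ∨ tailDegree b.2 + 1 = k ∧
    (b.1 ⊆ {0} ∨ ∃ j, j ≠ 0 ∧ b.2 j ≠ 0 ∧ ∀ s ∈ b.1, s ≠ 0 → j < s)

/-- The normal indices of the forms in `gradedForms K (Fin (n + 1)) m i`. -/
def normalSet (n k m i : ℕ) : Set (Finset (Fin (n + 1)) × (Fin (n + 1) →₀ ℕ)) :=
  {b | b.1.card = m ∧ b.2.degree + m = i ∧ IsNormal k b}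

lemma eq_of_coeff_monoForm_ne_zero {b : Finset (Fin (n + 1)) × (Fin (n + 1) →₀ ℕ)}
    {S : Finset (Fin (n + 1))} {γ : Fin (n + 1) →₀ ℕ} (h : (monoForm K b S).coeff γ ≠ 0) :
    b = (S, γ) := by
  rw [monoForm] at h
  by_cases hS : S = b.1
  · subst hS
    rw [Pi.single_eq_same, MvPolynomial.coeff_monomial] at h
    have : b.2 = γ := by by_contra hne; simp [hne] at h
    rw [← this]
  · simp [Pi.single_eq_of_ne hS] at h

lemma mem_of_coeff_ne_zero_of_mem_span
    {s : Set (Finset (Fin (n + 1)) × (Fin (n + 1) →₀ ℕ))}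
    {ω : Finset (Fin (n + 1)) → MvPolynomial (Fin (n + 1)) K}
    (hω : ω ∈ Submodule.span K (monoForm K '' s)) {S : Finset (Fin (n + 1))}
    {γ : Fin (n + 1) →₀ ℕ} (h : (ω S).coeff γ ≠ 0) : (S, γ) ∈ s := by
  induction hω using Submodule.span_induction with
  | mem ω hω =>
    obtain ⟨b, hb, rfl⟩ := hω
    rwa [← eq_of_coeff_monoForm_ne_zero h]
  | zero => simp at h
  | add ω η _ _ hω hη =>
    by_cases h1 : (ω S).coeff γ = 0
    · exact hη fun h2 => h (by simp [h1, h2])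
    · exact hω h1
  | smul c ω _ hω => exact hω fun h2 => h (by simp [h2])

lemma linearIndependent_monoForm :
    LinearIndependent K (monoForm K : Finset (Fin (n + 1)) × (Fin (n + 1) →₀ ℕ) → _) := by
  rw [linearIndependent_iff_notMem_span]
  intro b hb
  have := mem_of_coeff_ne_zero_of_mem_span hb (S := b.1) (γ := b.2) (by simp [monoForm])
  simp at this

variable {k : ℕ}

/-- By the tail-degree bounds only forms of tail degree k - 1 with S ⊄ {0} can occur, and the part
of dω in tail degree k - 2 must vanish. That part contains each coefficient of ω alone, up to a
nonzero factor, at a suitable position. -/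
lemma eq_zero_of_mem_relations (hk : ∀ a : ℕ, 1 ≤ a → a ≤ k → (a : K) ≠ 0) {m i : ℕ}
    {ω : Finset (Fin (n + 1)) → MvPolynomial (Fin (n + 1)) K}
    (hω : ω ∈ Submodule.span K (monoForm K '' normalSet n k m i))
    (hrel : ω ∈ relations (originIdeal K n ^ k)) : ω = 0 := by
  have key : ∀ S γ, (ω S).coeff γ ≠ 0 → tailDegree γ + 1 = k ∧
      ∃ j, j ≠ 0 ∧ γ j ≠ 0 ∧ ∀ s ∈ S, s ≠ 0 → j < s := by
    intro S γ h
    have h1 := le_of_mem_relations hrel h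
    obtain ⟨_, _, h2 | ⟨h2, h3 | h3⟩⟩ := mem_of_coeff_ne_zero_of_mem_span hω h
    · dsimp only at h2
      split_ifs at h1 <;> omega
    · dsimp only at h2 h3
      rw [if_pos h3] at h1
      omega
    · exact ⟨h2, h3⟩
  ext1 S
  ext γ
  by_contra h
  change (ω S).coeff γ ≠ 0 at h
  obtain ⟨hdeg, j, hj0, hj, hjS⟩ := key S γ h
  -- Let s be the least nonzero index occurring in γ. Normality provides some index of γ before all
  -- of S ∖ {0}, so s precedes them as well.
  obtain ⟨s, ⟨hs0, hs, hsS⟩, hmin⟩ : ∃ s, (s ≠ 0 ∧ γ s ≠ 0 ∧ ∀ t ∈ S, t ≠ 0 → s < t) ∧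
      ∀ l, l ≠ 0 → γ l ≠ 0 → s ≤ l := by
    have hne : (Finset.univ.filter fun l => l ≠ 0 ∧ γ l ≠ 0).Nonempty := ⟨j, by simp [hj0, hj]⟩
    have hmem := Finset.min'_mem _ hne
    have hle : ∀ l, l ≠ 0 → γ l ≠ 0 → Finset.min' _ hne ≤ l := fun l h1 h2 =>
      Finset.min'_le _ _ (by simp [h1, h2])
    simp only [Finset.mem_filter, Finset.mem_univ, true_and] at hmem
    exact ⟨_, ⟨hmem.1, hmem.2, fun t ht ht0 => (hle j hj0 hj).trans_lt (hjS t ht ht0)⟩, hle⟩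
  have hsS' : s ∉ S := fun h => (hsS s h hs0).false
  obtain ⟨δ, rfl⟩ := exists_eq_add_single hs
  rw [tailDegree_add, tailDegree_single_of_ne hs0] at hdeg
  have hzero : (extDeriv ω (insert s S)).coeff δ = 0 := by
    by_contra hne
    have := le_of_extDeriv_of_mem_relations hrel hne
    omega
  rw [coeff_extDeriv, Finset.sum_eq_single s, Finset.erase_insert hsS'] at hzero
  · have h1 : (shuffleSign s (insert s S) : K) ≠ 0 := by simp [shuffleSign]
    have h2 : ((δ s + 1 : ℕ) : K) ≠ 0 := hk _ (by omega) (by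
      have := apply_le_tailDegree hs0 δ
      omega)
    push_cast at h2
    exact mul_ne_zero h1 (mul_ne_zero h h2) hzero
  -- Any other contribution comes from a form still containing dX_s. Its normality needs a variable
  -- q < s: it is not l, as l ∈ S lies beyond s, and otherwise it occurs in γ, against the choice of
  -- s.
  · intro l hl hls
    by_contra hne
    obtain ⟨hdeg', q, hq0, hq, hqS⟩ :=
      key _ _ (left_ne_zero_of_mul (right_ne_zero_of_mul hne))
    have hl0 : l ≠ 0 := by
      rintro rfl
      rw [tailDegree_add, tailDegree_single_zero] at hdeg'
      omega
    have hqs : q < s := hqS s (Finset.mem_erase.2 ⟨Ne.symm hls, Finset.mem_insert_self _ _⟩) hs0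
    by_cases hql : q = l
    · subst hql
      exact (hsS q (Finset.mem_of_mem_insert_of_ne hl hls) hl0).asymm hqs
    · refine (hmin q hq0 ?_).not_gt hqs
      rw [Finsupp.add_apply, Finsupp.single_eq_of_ne hql] at hq
      simpa using fun h => absurd h hq
  · exact fun h => absurd (Finset.mem_insert_self s S) h

/-- If X^γ dX_S of tail degree k - 1 is not normal, let s be the least nonzero index of S. No
variable of γ other than X_0 precedes s, and the relation d(X^γ X_s) ∧ dX_{S ∖ s} expresses the form
through normal ones. -/
lemma monoForm_mem_sup (hk : ∀ a : ℕ, 1 ≤ a → a ≤ k → (a : K) ≠ 0) {m i : ℕ}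
    {b : Finset (Fin (n + 1)) × (Fin (n + 1) →₀ ℕ)} (hb : b.1.card = m ∧ b.2.degree + m = i) :
    monoForm K b ∈ Submodule.span K (monoForm K '' normalSet n k m i) ⊔
      (relations (originIdeal K n ^ k)).restrictScalars K := by
  obtain ⟨S, γ⟩ := b
  obtain ⟨hbS, hbγ⟩ := hb
  dsimp only at hbS hbγ
  by_cases hkd : k ≤ tailDegree γ
  · refine Submodule.mem_sup_right (mem_relations_of_forall_mem fun T => ?_)
    rw [monoForm]
    by_cases hT : T = S
    · subst hT
      simpa using monomial_mem_originIdeal_pow hkd 1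
    · simp [hT]
  by_cases hnorm : IsNormal k (S, γ)
  · exact Submodule.mem_sup_left (Submodule.subset_span ⟨_, ⟨hbS, hbγ, hnorm⟩, rfl⟩)
  simp only [IsNormal, not_or, not_and, not_exists, not_lt] at hnorm
  obtain ⟨hn1, hn2⟩ := hnorm
  have hdeg : tailDegree γ + 1 = k := by omega
  obtain ⟨hn3, hn4⟩ := hn2 hdeg
  have hne : (S.erase 0).Nonempty := by
    by_contra hemp
    exact hn3 fun t ht => Finset.mem_singleton.2 (by
      by_contra ht0
      exact hemp ⟨t, Finset.mem_erase.2 ⟨ht0, ht⟩⟩)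
  obtain ⟨s, ⟨hs0, hsS⟩, hmin⟩ : ∃ s, (s ≠ 0 ∧ s ∈ S) ∧ ∀ t ∈ S, t ≠ 0 → s ≤ t :=
    ⟨(S.erase 0).min' hne, Finset.mem_erase.1 (Finset.min'_mem _ hne),
      fun t ht ht0 => Finset.min'_le _ _ (Finset.mem_erase.2 ⟨ht0, ht⟩)⟩
  have hsγ : ∀ j, j ≠ 0 → γ j ≠ 0 → s ≤ j := fun j hj0 hj => by
    have := hn4 j hj0 hj
    push Not at this
    obtain ⟨t, ht, ht0, htj⟩ := this
    exact (hmin t ht ht0).trans htj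
  have hf : MvPolynomial.monomial (γ + Finsupp.single s 1) (1 : K) ∈ originIdeal K n ^ k :=
    monomial_mem_originIdeal_pow (by
      rw [tailDegree_add, tailDegree_single_of_ne hs0]; exact hdeg.ge) 1
  have hrel := wedgeDiff_mem_relations hf (Pi.single (S.erase s) 1)
  rw [wedgeDiff_apply, ← Finset.add_sum_erase _ _ (Finset.mem_univ s)] at hrel
  set N := Submodule.span K (monoForm K '' normalSet n k m i) ⊔
      (relations (originIdeal K n ^ k)).restrictScalars K
  have hterm : ∀ (l : Fin (n + 1)) (δ : Fin (n + 1) →₀ ℕ) (T : Finset (Fin (n + 1))),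
      l ∉ T → δ + Finsupp.single l 1 = γ + Finsupp.single s 1 →
      MvPolynomial.pderiv l (MvPolynomial.monomial (γ + Finsupp.single s 1) (1 : K)) •
        wedgeVar _ l (Pi.single T 1) =
      ((δ l + 1 : ℕ) * (shuffleSign l T : K)) • monoForm K (insert l T, δ) := by
    intro l δ T hlT hδ
    rw [← hδ, MvPolynomial.pderiv_monomial, wedgeVar_single _ _ _ hlT, add_tsub_cancel_right,
      monoForm, ← Pi.single_smul, ← Pi.single_smul,
      ← map_intCast (MvPolynomial.C (σ := Fin (n + 1)) (R := K)), smul_eq_mul, mul_one, mul_comm,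
      MvPolynomial.C_mul_monomial, MvPolynomial.smul_monomial]
    simp [mul_comm]
  have hothers : ∑ l ∈ Finset.univ.erase s,
      MvPolynomial.pderiv l (MvPolynomial.monomial (γ + Finsupp.single s 1) (1 : K)) •
        wedgeVar _ l (Pi.single (S.erase s) 1) ∈ N := by
    refine sum_mem fun l hl => ?_
    have hls : l ≠ s := (Finset.mem_erase.1 hl).1
    by_cases hlS : l ∈ S.erase s
    · rw [wedgeVar_single_of_mem _ _ _ hlS, smul_zero]
      exact zero_mem _
    by_cases hγl : γ l = 0
    · rw [MvPolynomial.pderiv_monomial]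
      simp [hγl, Finsupp.single_eq_of_ne hls]
    obtain ⟨δ, hδ⟩ := exists_eq_add_single (γ := γ + Finsupp.single s 1) (i := l) (by simp [hγl])
    by_cases hl0 : l = 0
    -- Differentiating by X_0 leaves tail degree k, so this coefficient lies in the ideal.
    · refine Submodule.mem_sup_right (smul_mem_relations ?_ _)
      rw [hδ, MvPolynomial.pderiv_monomial, add_tsub_cancel_right]
      refine monomial_mem_originIdeal_pow ?_ _
      have := congrArg tailDegree hδ
      rw [hl0, tailDegree_add, tailDegree_add, tailDegree_single_zero,
        tailDegree_single_of_ne hs0] at this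
      omega
    -- Here l > s, so δ still contains X_s, and s precedes every nonzero index of the new set: the
    -- term is normal.
    · rw [hterm l δ _ hlS hδ.symm]
      refine Submodule.smul_mem _ _ (Submodule.mem_sup_left (Submodule.subset_span ⟨_, ?_, rfl⟩))
      have hsl : s < l := lt_of_le_of_ne (hsγ l hl0 hγl) (Ne.symm hls)
      refine ⟨?_, ?_, Or.inr ⟨?_, Or.inr ⟨s, hs0, ?_, ?_⟩⟩⟩
      · rw [Finset.card_insert_of_notMem hlS, Finset.card_erase_add_one hsS, hbS]
      · have := congrArg Finsupp.degree hδ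
        simp only [map_add, Finsupp.degree_single] at this
        dsimp only
        omega
      · have := congrArg tailDegree hδ
        rw [tailDegree_add, tailDegree_add, tailDegree_single_of_ne hl0,
          tailDegree_single_of_ne hs0] at this
        dsimp only
        omega
      · have := DFunLike.congr_fun hδ s
        simp only [Finsupp.add_apply, Finsupp.single_eq_same,
          Finsupp.single_eq_of_ne (Ne.symm hls)] at this
        dsimp only
        omega
      · intro t ht ht0
        rcases Finset.mem_insert.1 ht with rfl | ht
        · exact hsl
        · exact lt_of_le_of_ne (hmin t (Finset.mem_of_mem_erase ht) ht0)
            (Finset.ne_of_mem_erase ht).symm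
  have hmain := sub_mem (Submodule.mem_sup_right hrel : _ ∈ N) hothers
  rw [add_sub_cancel_right, hterm s γ _ (Finset.notMem_erase s S) rfl,
    Finset.insert_erase hsS] at hmain
  -- The leading coefficient is ±(γ_s + 1), invertible since γ_s ≤ k - 1.
  refine (Submodule.smul_mem_iff _ (mul_ne_zero (hk _ (by omega) ?_) ?_)).1 hmain
  · have := apply_le_tailDegree hs0 γ
    omega
  · simp [shuffleSign]

lemma formsHilbert_originIdeal_pow (hk : ∀ a : ℕ, 1 ≤ a → a ≤ k → (a : K) ≠ 0) (m i : ℕ) :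
    formsHilbert (originIdeal K n ^ k) m i = (normalSet n k m i).ncard := by
  have hsub : normalSet n k m i ⊆ {b | b.1.card = m ∧ b.2.degree + m = i} :=
    fun b hb => ⟨hb.1, hb.2.1⟩
  set q := (relations (originIdeal K n ^ k)).mkQ.restrictScalars K
  have h1 : (gradedForms K (Fin (n + 1)) m i).map q =
      (Submodule.span K (monoForm K '' normalSet n k m i)).map q := by
    apply le_antisymm
    · rw [gradedForms_eq_span, Submodule.map_span_le]
      rintro _ ⟨b, hb, rfl⟩
      obtain ⟨u, hu, v, hv, h⟩ := Submodule.mem_sup.1 (monoForm_mem_sup hk hb)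
      refine ⟨u, hu, ?_⟩
      have hv' : q v = 0 := by simpa [q] using hv
      rw [← h, map_add, hv', add_zero]
    · rw [gradedForms_eq_span]
      exact Submodule.map_mono (Submodule.span_mono (Set.image_mono hsub))
  rw [formsHilbert, h1]
  have h2 : Function.Injective
      (q.domRestrict (Submodule.span K (monoForm K '' normalSet n k m i))) := by
    rw [injective_iff_map_eq_zero]
    intro ω hω
    refine Subtype.ext (eq_zero_of_mem_relations hk ω.2 ?_)
    simpa [q] using hω
  have h3 := LinearMap.finrank_range_of_inj h2
  rw [LinearMap.range_domRestrict] at h3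
  rw [h3, Set.image_eq_range]
  have := ((finite_degree_indices m i).subset hsub).fintype
  have := finrank_span_eq_card (R := K) (b := fun x : normalSet n k m i => monoForm K x.1)
    (linearIndependent_monoForm.comp _ Subtype.val_injective)
  rw [this, ← Nat.card_eq_fintype_card, Nat.card_coe_set_eq]

end OriginIdeal

/-! ### Counting the normal forms. -/

section Counting

lemma ncard_degree_eq (n j : ℕ) :
    {γ : Fin n →₀ ℕ | γ.degree = j}.ncard = (n + j - 1).choose j := by
  have : {γ : Fin n →₀ ℕ | γ.degree = j} =
      ((Finset.univ : Finset (Fin n)).finsuppAntidiag j : Set (Fin n →₀ ℕ)) := by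
    ext γ
    simp [Finset.mem_finsuppAntidiag, Finsupp.degree_eq_sum]
  rw [this, Set.ncard_coe_finset, Finset.card_finsuppAntidiag_nat_eq_choose]
  simp

lemma ncard_card_eq (n m : ℕ) : {S : Finset (Fin n) | S.card = m}.ncard = n.choose m := by
  have : {S : Finset (Fin n) | S.card = m} =
      ((Finset.univ : Finset (Fin n)).powersetCard m : Set (Finset (Fin n))) := by
    ext S
    simp [Finset.mem_powersetCard]
  rw [this, Set.ncard_coe_finset, Finset.card_powersetCard]
  simp

/-- The pairs of a set of size `m` and a monomial of degree `j` such that some variable of the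
monomial comes before all elements of the set. -/
def tailNormal (n j m : ℕ) : Set (Finset (Fin n) × (Fin n →₀ ℕ)) :=
  {b | b.1.card = m ∧ b.2.degree = j ∧ (b.1 = ∅ ∨ ∃ l, b.2 l ≠ 0 ∧ ∀ s ∈ b.1, l < s)}

lemma finite_card_degree (n j m : ℕ) :
    {b : Finset (Fin n) × (Fin n →₀ ℕ) | b.1.card = m ∧ b.2.degree = j}.Finite :=
  (Set.finite_univ.prod (Finsupp.finite_of_degree_eq j)).subset fun _ hb => ⟨trivial, hb.2⟩

lemma finite_tailNormal (n j m : ℕ) : (tailNormal n j m).Finite :=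
  (finite_card_degree n j m).subset fun _ hb => ⟨hb.1, hb.2.1⟩

lemma ncard_tailNormal_zero_right (n j : ℕ) : (tailNormal n j 0).ncard = (n + j - 1).choose j := by
  have : tailNormal n j 0 = {∅} ×ˢ {γ : Fin n →₀ ℕ | γ.degree = j} := by
    ext ⟨S, γ⟩
    simp +contextual [tailNormal]
  rw [this, Set.ncard_prod, ncard_degree_eq]
  simp

lemma ncard_tailNormal_zero_middle (n m : ℕ) : (tailNormal n 0 (m + 1)).ncard = 0 := by
  have : tailNormal n 0 (m + 1) = ∅ := by
    refine Set.eq_empty_of_forall_notMem ?_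
    rintro ⟨S, γ⟩ ⟨h1, h2, h3 | ⟨l, hl, _⟩⟩
    · dsimp only at h1 h3
      simp [h3] at h1
    · rw [Finsupp.degree_eq_zero_iff] at h2
      dsimp only at h2 hl
      simp [h2] at hl
  rw [this, Set.ncard_empty]

lemma map_succ_injective {n : ℕ} :
    Function.Injective (Finset.map (Fin.succEmb n)) := Finset.map_injective _

lemma zero_notMem_map_succ {n : ℕ} (S : Finset (Fin n)) : 0 ∉ S.map (Fin.succEmb n) := by
  simp [Fin.succ_ne_zero]

lemma exists_map_succ_eq {n : ℕ} {S : Finset (Fin (n + 1))} (h : 0 ∉ S) :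
    ∃ T : Finset (Fin n), T.map (Fin.succEmb n) = S := by
  refine ⟨Finset.univ.filter fun i => i.succ ∈ S, ?_⟩
  ext i
  refine Fin.cases ?_ (fun j => ?_) i
  · simp [h, Fin.succ_ne_zero]
  · simp

lemma degree_cons {n : ℕ} (a : ℕ) (β : Fin n →₀ ℕ) : (Finsupp.cons a β).degree = a + β.degree := by
  simp [Finsupp.degree_eq_sum, Fin.sum_univ_succ]

/-- The set S cannot contain the first index, since some variable precedes it. Either the first
variable is absent from the monomial and can be dropped, or it occurs and the order condition on S
is automatic. -/
lemma tailNormal_succ (n j m : ℕ) : tailNormal (n + 1) (j + 1) (m + 1) =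
    (Prod.map (Finset.map (Fin.succEmb n)) (Finsupp.cons 0)) '' tailNormal n (j + 1) (m + 1) ∪
    (Prod.map (Finset.map (Fin.succEmb n)) (· + Finsupp.single 0 1)) ''
      ({S : Finset (Fin n) | S.card = m + 1} ×ˢ {γ : Fin (n + 1) →₀ ℕ | γ.degree = j}) := by
  ext ⟨S, γ⟩
  constructor
  · rintro ⟨h1, h2, h3⟩
    dsimp only at h1 h2 h3
    have hS : S ≠ ∅ := by rintro rfl; simp at h1
    obtain ⟨l, hl, hlS⟩ := h3.resolve_left hS
    obtain ⟨T, rfl⟩ := exists_map_succ_eq fun h0 => (Fin.not_lt_zero _ (hlS 0 h0))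
    rw [Finset.card_map] at h1
    by_cases hγ : γ 0 = 0
    · refine Or.inl ⟨(T, γ.tail), ⟨h1, ?_, Or.inr ?_⟩, ?_⟩
      · rw [← Finsupp.cons_tail γ, degree_cons, hγ, zero_add] at h2
        exact h2
      · have hl0 : l ≠ 0 := by rintro rfl; exact hl hγ
        obtain ⟨q, rfl⟩ := Fin.exists_succ_eq.2 hl0
        refine ⟨q, hl, fun s hs => ?_⟩
        exact Fin.succ_lt_succ_iff.1 (hlS s.succ (Finset.mem_map_of_mem (Fin.succEmb n) hs))
      · rw [Prod.map_apply, ← hγ, Finsupp.cons_tail]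
    · obtain ⟨δ, rfl⟩ := exists_eq_add_single hγ
      refine Or.inr ⟨(T, δ), ⟨h1, ?_⟩, rfl⟩
      simpa using h2
  · rintro (⟨⟨T, β⟩, ⟨h1, h2, h3⟩, h⟩ | ⟨⟨T, δ⟩, ⟨h1, h2⟩, h⟩)
    · obtain ⟨rfl, rfl⟩ := Prod.mk.inj h
      dsimp only at h1 h2 h3
      refine ⟨by simpa using h1, by simpa [degree_cons] using h2, Or.inr ?_⟩
      have hT : T ≠ ∅ := by rintro rfl; simp at h1
      obtain ⟨l, hl, hlT⟩ := h3.resolve_left hT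
      refine ⟨l.succ, by simpa using hl, fun s hs => ?_⟩
      obtain ⟨q, hq, rfl⟩ := Finset.mem_map.1 hs
      exact Fin.succ_lt_succ_iff.2 (hlT q hq)
    · obtain ⟨rfl, rfl⟩ := Prod.mk.inj h
      refine ⟨by simpa using h1, by simpa using h2, Or.inr ⟨0, by simp, fun s hs => ?_⟩⟩
      obtain ⟨q, hq, rfl⟩ := Finset.mem_map.1 hs
      exact Fin.succ_pos q

lemma cons_injective {n : ℕ} (a : ℕ) :
    Function.Injective (Finsupp.cons a : (Fin n →₀ ℕ) → (Fin (n + 1) →₀ ℕ)) :=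
  fun β β' h => by rw [← Finsupp.tail_cons a β, h, Finsupp.tail_cons]

lemma ncard_tailNormal_succ (n j m : ℕ) : (tailNormal (n + 1) (j + 1) (m + 1)).ncard =
    (tailNormal n (j + 1) (m + 1)).ncard + n.choose (m + 1) * (n + j).choose j := by
  rw [tailNormal_succ, Set.ncard_union_eq ?_ ?_ ?_]
  · rw [Set.ncard_image_of_injective _ (map_succ_injective.prodMap (cons_injective 0)),
      Set.ncard_image_of_injective _ (map_succ_injective.prodMap (add_left_injective _)),
      Set.ncard_prod, ncard_card_eq, ncard_degree_eq, add_right_comm, Nat.add_sub_cancel]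
  · rw [Set.disjoint_left]
    rintro _ ⟨⟨T, β⟩, _, rfl⟩ ⟨⟨T', δ⟩, _, h⟩
    have := DFunLike.congr_fun (congrArg Prod.snd h) 0
    simp at this
  · exact (finite_tailNormal _ _ _).image _
  · exact ((Set.toFinite _).prod (Finsupp.finite_of_degree_eq j)).image _

lemma ncard_tailNormal (n j m : ℕ) : (tailNormal n (j + 1) (m + 1)).ncard =
    (n + j).choose (j + m + 2) * (j + m + 1).choose (m + 1) := by
  induction n with
  | zero =>
    have : tailNormal 0 (j + 1) (m + 1) = ∅ := by
      refine Set.eq_empty_of_forall_notMem ?_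
      rintro ⟨S, γ⟩ ⟨h1, _⟩
      simp [Finset.eq_empty_of_isEmpty S] at h1
    rw [this, Set.ncard_empty, Nat.choose_eq_zero_of_lt (by omega), zero_mul]
  | succ n ih =>
    -- With this identity the recursion becomes Pascal's rule for C(n + j + 1, j + m + 2).
    have h : (n + j).choose (j + m + 1) * (j + m + 1).choose j =
        (n + j).choose j * n.choose (m + 1) := by
      rcases lt_or_ge (n + j) (j + m + 1) with hlt | hge
      · rw [Nat.choose_eq_zero_of_lt hlt, Nat.choose_eq_zero_of_lt (by omega : n < m + 1)]
        simp
      · rw [Nat.choose_mul (by omega)]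
        congr 2 <;> omega
    have hsymm : (j + m + 1).choose j = (j + m + 1).choose (m + 1) :=
      Nat.choose_symm_of_eq_add (by omega)
    rw [ncard_tailNormal_succ, ih, add_right_comm n 1 j,
      Nat.choose_succ_succ (n + j) (j + m + 1), add_mul, ← hsymm,
      show (j + m + 1).succ = j + m + 2 from rfl, h]
    ring

variable {n : ℕ}

lemma degree_eq_add_tailDegree (γ : Fin (n + 1) →₀ ℕ) : γ.degree = γ 0 + tailDegree γ := by
  rw [Finsupp.degree_eq_sum, Fin.sum_univ_succ, tailDegree]

lemma degree_tail (γ : Fin (n + 1) →₀ ℕ) : γ.tail.degree = tailDegree γ := by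
  rw [Finsupp.degree_eq_sum, tailDegree]
  rfl

lemma tailDegree_cons (a : ℕ) (β : Fin n →₀ ℕ) : tailDegree (Finsupp.cons a β) = β.degree := by
  rw [← degree_tail, Finsupp.tail_cons]

/-- The normal indices of the top degree. -/
def topNormal (n j m i : ℕ) : Set (Finset (Fin (n + 1)) × (Fin (n + 1) →₀ ℕ)) :=
  {b | b.1.card = m ∧ b.2.degree + m = i ∧ tailDegree b.2 = j ∧
    (b.1 ⊆ {0} ∨ ∃ l, l ≠ 0 ∧ b.2 l ≠ 0 ∧ ∀ s ∈ b.1, s ≠ 0 → l < s)}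

lemma topNormal_condition_iff (S : Finset (Fin (n + 1))) (T : Finset (Fin n))
    (hST : S = T.map (Fin.succEmb n) ∨ S = insert 0 (T.map (Fin.succEmb n)))
    (a : ℕ) (β : Fin n →₀ ℕ) :
    (S ⊆ {0} ∨ ∃ l, l ≠ 0 ∧ Finsupp.cons a β l ≠ 0 ∧ ∀ s ∈ S, s ≠ 0 → l < s) ↔
      (T = ∅ ∨ ∃ l, β l ≠ 0 ∧ ∀ s ∈ T, l < s) := by
  have hmem : ∀ s : Fin n, s.succ ∈ S ↔ s ∈ T := fun s => by
    rcases hST with rfl | rfl <;> simp [Fin.succ_ne_zero]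
  refine or_congr ?_ ?_
  · constructor
    · intro h
      refine Finset.eq_empty_of_forall_notMem fun s hs => ?_
      exact Fin.succ_ne_zero s (Finset.mem_singleton.1 (h ((hmem s).2 hs)))
    · rintro rfl s hs
      refine Finset.mem_singleton.2 ?_
      by_contra hs0
      obtain ⟨q, rfl⟩ := Fin.exists_succ_eq.2 hs0
      exact Finset.notMem_empty q ((hmem q).1 hs)
  · constructor
    · rintro ⟨l, hl0, hl, h⟩
      obtain ⟨q, rfl⟩ := Fin.exists_succ_eq.2 hl0
      refine ⟨q, by simpa using hl, fun s hs => ?_⟩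
      exact Fin.succ_lt_succ_iff.1 (h _ ((hmem s).2 hs) (Fin.succ_ne_zero s))
    · rintro ⟨l, hl, h⟩
      refine ⟨l.succ, Fin.succ_ne_zero l, by simpa using hl, fun s hs hs0 => ?_⟩
      obtain ⟨q, rfl⟩ := Fin.exists_succ_eq.2 hs0
      exact Fin.succ_lt_succ_iff.2 (h q ((hmem q).1 hs))

lemma insert_zero_map_succ_injective :
    Function.Injective fun T : Finset (Fin n) => insert 0 (T.map (Fin.succEmb n)) := by
  intro T T' h
  have := congrArg (fun S => S.erase 0) h
  simp only [Finset.erase_insert (zero_notMem_map_succ _)] at this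
  exact map_succ_injective this

/-- The total degree fixes the exponent of X_0, and the order condition ignores the index 0. What
remains is a choice in n variables, according to whether dX_0 occurs. -/
lemma topNormal_eq {j m i : ℕ} (hi : j + (m + 1) ≤ i) : topNormal n j (m + 1) i =
    (Prod.map (Finset.map (Fin.succEmb n)) (Finsupp.cons (i - (m + 1) - j))) ''
      tailNormal n j (m + 1) ∪
    (Prod.map (fun T : Finset (Fin n) => insert 0 (T.map (Fin.succEmb n)))
      (Finsupp.cons (i - (m + 1) - j))) '' tailNormal n j m := by
  ext ⟨S, γ⟩
  constructor
  · rintro ⟨h1, h2, h3, h4⟩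
    dsimp only at h1 h2 h3 h4
    have hγ : Finsupp.cons (i - (m + 1) - j) γ.tail = γ := by
      rw [degree_eq_add_tailDegree] at h2
      rw [show i - (m + 1) - j = γ 0 by omega, Finsupp.cons_tail]
    rw [← hγ] at h4
    by_cases h0 : 0 ∈ S
    · obtain ⟨T, hT⟩ := exists_map_succ_eq (Finset.notMem_erase 0 S)
      have hS : S = insert 0 (T.map (Fin.succEmb n)) := by rw [hT, Finset.insert_erase h0]
      refine Or.inr ⟨(T, γ.tail), ⟨?_, ?_, ?_⟩, by rw [Prod.map_apply, hγ, hS]⟩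
      · rw [hS, Finset.card_insert_of_notMem (zero_notMem_map_succ T), Finset.card_map] at h1
        simpa using h1
      · rw [degree_tail, h3]
      · exact (topNormal_condition_iff S T (Or.inr hS) _ _).1 h4
    · obtain ⟨T, hT⟩ := exists_map_succ_eq h0
      refine Or.inl ⟨(T, γ.tail), ⟨?_, ?_, ?_⟩, by rw [Prod.map_apply, hγ, hT]⟩
      · rwa [← hT, Finset.card_map] at h1
      · rw [degree_tail, h3]
      · exact (topNormal_condition_iff S T (Or.inl hT.symm) _ _).1 h4
  · rintro (⟨⟨T, β⟩, ⟨h1, h2, h3⟩, h⟩ | ⟨⟨T, β⟩, ⟨h1, h2, h3⟩, h⟩)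
    · obtain ⟨rfl, rfl⟩ := Prod.mk.inj h
      dsimp only at h1 h2 h3
      refine ⟨by simpa using h1, ?_, by rw [tailDegree_cons, h2],
        (topNormal_condition_iff _ T (Or.inl rfl) _ _).2 h3⟩
      rw [degree_cons, h2]
      omega
    · obtain ⟨rfl, rfl⟩ := Prod.mk.inj h
      dsimp only at h1 h2 h3
      refine ⟨?_, ?_, by rw [tailDegree_cons, h2],
        (topNormal_condition_iff _ T (Or.inr rfl) _ _).2 h3⟩
      · dsimp only
        rw [Finset.card_insert_of_notMem (zero_notMem_map_succ T), Finset.card_map, h1]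
      · rw [degree_cons, h2]
        omega

lemma ncard_topNormal {j m i : ℕ} (hi : j + (m + 1) ≤ i) : (topNormal n j (m + 1) i).ncard =
    (tailNormal n j (m + 1)).ncard + (tailNormal n j m).ncard := by
  rw [topNormal_eq hi, Set.ncard_union_eq ?_ ?_ ?_]
  · rw [Set.ncard_image_of_injective _ (map_succ_injective.prodMap (cons_injective _)),
      Set.ncard_image_of_injective _ (insert_zero_map_succ_injective.prodMap (cons_injective _))]
  · rw [Set.disjoint_left]
    rintro _ ⟨⟨T, β⟩, _, rfl⟩ ⟨⟨T', δ⟩, _, h⟩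
    have h1 : insert 0 (T'.map (Fin.succEmb n)) = T.map (Fin.succEmb n) := congrArg Prod.fst h
    exact zero_notMem_map_succ T (h1 ▸ Finset.mem_insert_self _ _)
  · exact (finite_tailNormal _ _ _).image _
  · exact (finite_tailNormal _ _ _).image _

lemma normalSet_one (m i : ℕ) : normalSet n 1 m i = topNormal n 0 m i := by
  ext ⟨S, γ⟩
  simp [normalSet, topNormal, IsNormal]

/-- Below the top tail degree S is arbitrary. Monomials of fixed large degree and tail degree at
most j are exactly X_0^(i - m - j) times an arbitrary monomial of degree j in all n + 1 variables.
-/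
lemma normalSet_add_two {j m i : ℕ} (hi : j + m ≤ i) : normalSet n (j + 2) m i =
    {S : Finset (Fin (n + 1)) | S.card = m} ×ˢ
      ((· + Finsupp.single 0 (i - m - j)) '' {γ : Fin (n + 1) →₀ ℕ | γ.degree = j}) ∪
    topNormal n (j + 1) m i := by
  have key : ∀ γ : Fin (n + 1) →₀ ℕ,
      γ ∈ (· + Finsupp.single 0 (i - m - j)) '' {γ : Fin (n + 1) →₀ ℕ | γ.degree = j} ↔
        γ.degree + m = i ∧ tailDegree γ ≤ j := by
    intro γ
    constructor
    · rintro ⟨δ, hδ, rfl⟩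
      have h1 : δ.degree = j := hδ
      have h2 := degree_eq_add_tailDegree δ
      simp only [map_add, Finsupp.degree_single, tailDegree_add, tailDegree_single_zero]
      omega
    · rintro ⟨h1, h2⟩
      rw [degree_eq_add_tailDegree] at h1
      have hle : Finsupp.single 0 (i - m - j) ≤ γ := Finsupp.single_le_iff.2 (by omega)
      have hγ := tsub_add_cancel_of_le hle
      refine ⟨γ - Finsupp.single 0 (i - m - j), ?_, hγ⟩
      have h3 := congrArg Finsupp.degree hγ
      rw [map_add, Finsupp.degree_single, degree_eq_add_tailDegree γ] at h3
      change Finsupp.degree _ = j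
      omega
  ext ⟨S, γ⟩
  rw [Set.mem_union, Set.mem_prod, key]
  simp only [normalSet, topNormal, IsNormal, Set.mem_ofPred_eq]
  constructor
  · rintro ⟨h1, h2, h3 | ⟨h3, h4⟩⟩
    · exact Or.inl ⟨h1, h2, by omega⟩
    · exact Or.inr ⟨h1, h2, by omega, h4⟩
  · rintro (⟨h1, h2, h3⟩ | ⟨h1, h2, h3, h4⟩)
    · exact ⟨h1, h2, Or.inl (by omega)⟩
    · exact ⟨h1, h2, Or.inr ⟨by omega, h4⟩⟩

lemma ncard_normalSet_one {m i : ℕ} (hi : m + 1 ≤ i) : (normalSet n 1 (m + 1) i).ncard =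
    (tailNormal n 0 (m + 1)).ncard + (tailNormal n 0 m).ncard := by
  rw [normalSet_one, ncard_topNormal (by omega)]

lemma ncard_normalSet_add_two {j m i : ℕ} (hi : j + 1 + (m + 1) ≤ i) :
    (normalSet n (j + 2) (m + 1) i).ncard = (n + 1).choose (m + 1) * (n + j).choose j +
      ((tailNormal n (j + 1) (m + 1)).ncard + (tailNormal n (j + 1) m).ncard) := by
  rw [normalSet_add_two (by omega), Set.ncard_union_eq ?_ ?_ ?_, ncard_topNormal hi, Set.ncard_prod,
    ncard_card_eq, Set.ncard_image_of_injective _ (add_left_injective _), ncard_degree_eq,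
    add_right_comm, Nat.add_sub_cancel]
  · rw [Set.disjoint_left]
    rintro ⟨S, _⟩ ⟨_, δ, hδ, rfl⟩ ⟨_, _, h, _⟩
    have h1 : δ.degree = j := hδ
    have h2 := degree_eq_add_tailDegree δ
    simp only [tailDegree_add, tailDegree_single_zero] at h
    omega
  · exact (Set.toFinite _).prod ((Finsupp.finite_of_degree_eq j).image _)
  · rw [topNormal_eq hi]
    exact ((finite_tailNormal _ _ _).image _).union ((finite_tailNormal _ _ _).image _)

end Counting

/-! ### Agreement with the binomial formulas. -/

section Binomials

lemma binom_natCast (a b : ℕ) : binom a b = a.choose b := by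
  simp [binom, Ring.choose_natCast]

lemma binom_eq_choose {a b : ℤ} {c d : ℕ} (ha : a = c) (hb : b = d) : binom a b = c.choose d := by
  rw [ha, hb, binom_natCast]

lemma binom_of_neg {a b : ℤ} (hb : b < 0) : binom a b = 0 := if_neg hb.not_ge

lemma binom_zero_right (a : ℤ) : binom a 0 = 1 := by simp [binom]

variable {n : ℕ}

lemma ncard_normalSet_of_degree_one {k i : ℕ} (hk : 1 ≤ k) (hi : k + 1 ≤ i) :
    ((normalSet n k 1 i).ncard : ℤ) =
      binom (n + k - 1) n + (k - 1) * binom (n + k - 1) (n - 1) := by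
  obtain rfl | ⟨j, rfl⟩ : k = 1 ∨ ∃ j, k = j + 2 := by
    rcases k with _ | _ | j
    · omega
    · exact Or.inl rfl
    · exact Or.inr ⟨j, rfl⟩
  · rw [ncard_normalSet_one (by omega), ncard_tailNormal_zero_middle, ncard_tailNormal_zero_right,
      binom_eq_choose (c := n) (d := n) (by push_cast; ring) rfl]
    simp
  · rw [ncard_normalSet_add_two (by omega), ncard_tailNormal, ncard_tailNormal_zero_right,
      binom_eq_choose (c := n + j + 1) (d := n) (by push_cast; ring) rfl]
    rcases n with _ | r
    · rw [binom_of_neg (by simp)]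
      simp [Nat.choose_eq_zero_of_lt (show j < j + 2 by omega)]
    · rw [binom_eq_choose (c := r + 1 + j + 1) (d := r) (by push_cast; ring) (by push_cast; ring)]
      have h1 : (r + 1 + j + 1).choose (r + 1) =
          (r + 1 + j).choose j + (r + 1 + j).choose (j + 1) := by
        rw [Nat.choose_symm_of_eq_add (show r + 1 + j + 1 = (r + 1) + (j + 1) by ring),
          Nat.choose_succ_succ]
      have h2 : (r + 1 + j + 1).choose r =
          (r + 1 + j).choose (j + 1) + (r + 1 + j).choose (j + 2) := by
        rw [Nat.choose_symm_of_eq_add (show r + 1 + j + 1 = r + (j + 2) by ring),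
          Nat.choose_succ_succ]
      -- With N = r + 1 + j this is (j + 1) C(N, j + 1) = (r + 1) C(N, j), the relation needed after
      -- Pascal's rule has been applied to both target binomials.
      have h3 := Nat.choose_succ_right_eq (r + 1 + j) j
      rw [Nat.add_sub_cancel] at h3
      rw [h1, h2, show r + 1 + (j + 1) - 1 = r + 1 + j by omega]
      zify at h3
      simp only [zero_add, add_zero, Nat.choose_one_right]
      push_cast
      linear_combination -h3

/-- The first product counts tail degree at most k - 2. The two products of δ count the top tail
degree k - 1 without and with dX_0. -/
lemma ncard_normalSet_of_degree_le {k m i : ℕ} (hk : 1 ≤ k) (hm : 1 < m) (hmn : m ≤ n)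
    (hi : k + m ≤ i) :
    ((normalSet n k m i).ncard : ℤ) =
      binom (n + 1) m * binom (n + k - 2) n +
        (binom (m + k - 2) m * binom (n + k - 2) (n - m - 1) +
          binom (m + k - 3) (m - 1) * binom (n + k - 2) (n - m)) := by
  obtain ⟨l, rfl⟩ : ∃ l, m = l + 2 := ⟨m - 2, by omega⟩
  obtain ⟨r, rfl⟩ : ∃ r, n = l + 2 + r := ⟨n - (l + 2), by omega⟩
  obtain rfl | ⟨j, rfl⟩ : k = 1 ∨ ∃ j, k = j + 2 := by
    rcases k with _ | _ | j
    · omega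
    · exact Or.inl rfl
    · exact Or.inr ⟨j, rfl⟩
  · rw [ncard_normalSet_one (by omega), ncard_tailNormal_zero_middle, ncard_tailNormal_zero_middle,
      binom_eq_choose (a := _ - 2) (c := l + 1 + r) (d := l + 2 + r) (by push_cast; ring) rfl,
      binom_eq_choose (a := _ + _ - 2) (b := ((l + 2 : ℕ) : ℤ)) (c := l + 1) (d := l + 2)
        (by push_cast; ring) rfl,
      binom_eq_choose (a := _ - 3) (c := l) (d := l + 1) (by push_cast; ring)
        (by push_cast; ring),
      Nat.choose_eq_zero_of_lt (show l + 1 + r < l + 2 + r by omega)]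
    simp
  · rw [ncard_normalSet_add_two (by omega), ncard_tailNormal, ncard_tailNormal,
      binom_eq_choose (c := l + 2 + r + 1) (d := l + 2) (by push_cast; ring) rfl,
      binom_eq_choose (b := ((l + 2 + r : ℕ) : ℤ)) (c := l + 2 + r + j) (d := l + 2 + r)
        (by push_cast; ring) rfl,
      binom_eq_choose (b := ((l + 2 : ℕ) : ℤ)) (c := l + 2 + j) (d := l + 2)
        (by push_cast; ring) rfl,
      binom_eq_choose (a := _ - 3) (c := j + l + 1) (d := l + 1) (by push_cast; ring)
        (by push_cast; ring),
      binom_eq_choose (b := ((l + 2 + r : ℕ) : ℤ) - ((l + 2 : ℕ) : ℤ)) (c := l + 2 + r + j)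
        (d := r) (by push_cast; ring) (by push_cast; ring),
      Nat.choose_symm_of_eq_add (show l + 2 + r + j = (l + 2 + r) + j by ring),
      Nat.choose_symm_of_eq_add (show l + 2 + r + j = r + (j + l + 2) by ring)]
    have h : binom (((l + 2 + r : ℕ) : ℤ) + ((j + 2 : ℕ) : ℤ) - 2)
        (((l + 2 + r : ℕ) : ℤ) - ((l + 2 : ℕ) : ℤ) - 1) =
        (l + 2 + r + j).choose (j + (l + 1) + 2) := by
      rcases r with _ | r
      · rw [binom_of_neg (by simp), Nat.choose_eq_zero_of_lt (by omega), Nat.cast_zero]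
      · rw [binom_eq_choose (c := l + 2 + (r + 1) + j) (d := r) (by push_cast; ring)
          (by push_cast; ring), Nat.choose_symm_of_eq_add (b := j + (l + 1) + 2) (by ring)]
    rw [h, show l + 2 + j = j + (l + 1) + 1 by ring]
    push_cast
    ring

lemma ncard_normalSet_of_degree_top {k i : ℕ} (hk : 1 ≤ k) (hi : k + (n + 1) ≤ i) :
    ((normalSet n k (n + 1) i).ncard : ℤ) = binom (n + k - 2) n := by
  obtain rfl | ⟨j, rfl⟩ : k = 1 ∨ ∃ j, k = j + 2 := by
    rcases k with _ | _ | j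
    · omega
    · exact Or.inl rfl
    · exact Or.inr ⟨j, rfl⟩
  · rw [ncard_normalSet_one (by omega), ncard_tailNormal_zero_middle]
    rcases n with _ | r
    -- For n = 0 and k = 1 the upper argument is -1; the convention that `binom a 0` is 1 for every
    -- integer a is needed.
    · rw [ncard_tailNormal_zero_right]
      simp [binom_zero_right]
    · rw [ncard_tailNormal_zero_middle,
        binom_eq_choose (c := r) (d := r + 1) (by push_cast; ring) rfl]
      simp
  -- No variable can precede all n indices, so for m = n + 1 the top tail degree contributes
  -- nothing; for n = 0 no monomial of positive degree exists.
  · have h : (tailNormal n (j + 1) n).ncard = 0 := by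
      rcases n with _ | r
      · rw [ncard_tailNormal_zero_right, Nat.choose_eq_zero_of_lt (by omega)]
      · rw [ncard_tailNormal, Nat.choose_eq_zero_of_lt (by omega), zero_mul]
    rw [ncard_normalSet_add_two (by omega), h, ncard_tailNormal,
      Nat.choose_eq_zero_of_lt (show n + j < j + n + 2 by omega),
      binom_eq_choose (c := n + j) (d := n) (by push_cast; ring) rfl,
      Nat.choose_symm_add]
    simp

end Binomials

/-! ### Assembly over all points. -/

variable {K : Type*} [Field K] {n : ℕ}

lemma natCast_ne_zero_of_ringChar {k : ℕ} (h : ringChar K = 0 ∨ k < ringChar K) (a : ℕ)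
    (ha : 1 ≤ a) (hak : a ≤ k) : (a : K) ≠ 0 := by
  rw [Ne, ringChar.spec]
  intro hdvd
  have := Nat.le_of_dvd ha hdvd
  rcases h with h | h
  · rw [h, zero_dvd_iff] at hdvd
    omega
  · omega

lemma hasHilbertPolynomial_of_ncard_normalSet {t : ℕ} {p : Fin t → ℙ K (Fin (n + 1) → K)}
    (hp : Function.Injective p) {mult : Fin t → ℕ} (hmult : ∀ i, 1 ≤ mult i)
    (hchar : ringChar K = 0 ∨ ∀ i, mult i < ringChar K) {m : ℕ} (c : ℕ → ℤ)
    (hc : ∀ k i, 1 ≤ k → k + m ≤ i → ((normalSet n k m i).ncard : ℤ) = c k) :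
    HasHilbertPolynomial (fatPointIdeal p mult) m (∑ i, c (mult i)) := by
  rw [hasHilbertPolynomial_iff]
  obtain ⟨i₀, h⟩ := exists_formsHilbert_fatPointIdeal hp mult m
  -- The sum of the multiplicities bounds each of them, so one threshold makes all local counts
  -- stable.
  refine ⟨max i₀ (∑ j, mult j + m), fun i hi => ?_⟩
  rw [h i (le_of_max_le_left hi), Nat.cast_sum]
  refine Finset.sum_congr rfl fun j _ => ?_
  rw [formsHilbert_originIdeal_pow (natCast_ne_zero_of_ringChar (hchar.imp_right fun h => h j))]
  refine hc _ _ (hmult j) ?_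
  have h1 := le_of_max_le_right hi
  have h2 : mult j ≤ ∑ j, mult j := Finset.single_le_sum (fun _ _ => Nat.zero_le _)
    (Finset.mem_univ j)
  omega

end FatPoint

theorem mainTheorem4 {K : Type*} [Field K] [PerfectField K] {n t : ℕ} (ht : 1 ≤ t)
    (p : Fin t → ℙ K (Fin (n + 1) → K)) (hp : Function.Injective p)
    (mult : Fin t → ℕ) (hmult : ∀ i, 1 ≤ mult i)
    (hchar : ringChar K = 0 ∨ ∀ i, mult i < ringChar K) :
    FatPoint.HasHilbertPolynomial (FatPoint.fatPointIdeal p mult) 1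
      (∑ i, (binom (n + mult i - 1) n + (mult i - 1) * binom (n + mult i - 1) (n - 1))) ∧
    (∀ m : ℕ, 1 < m → m ≤ n →
      FatPoint.HasHilbertPolynomial (FatPoint.fatPointIdeal p mult) m
        (∑ i, (binom (n + 1) m * binom (n + mult i - 2) n +
          (binom (m + mult i - 2) m * binom (n + mult i - 2) (n - m - 1) +
            binom (m + mult i - 3) (m - 1) * binom (n + mult i - 2) (n - m))))) ∧
    FatPoint.HasHilbertPolynomial (FatPoint.fatPointIdeal p mult) (n + 1)
      (∑ i, binom (n + mult i - 2) n) := by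
  refine ⟨?_, fun m hm hmn => ?_, ?_⟩
  · exact FatPoint.hasHilbertPolynomial_of_ncard_normalSet hp hmult hchar
      (fun k => binom (n + k - 1) n + (k - 1) * binom (n + k - 1) (n - 1))
      fun k i hk hi => FatPoint.ncard_normalSet_of_degree_one hk hi
  · exact FatPoint.hasHilbertPolynomial_of_ncard_normalSet hp hmult hchar
      (fun k => binom (n + 1) m * binom (n + k - 2) n +
          (binom (m + k - 2) m * binom (n + k - 2) (n - m - 1) +
            binom (m + k - 3) (m - 1) * binom (n + k - 2) (n - m)))
      fun k i hk hi => FatPoint.ncard_normalSet_of_degree_le hk hm hmn hi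
  · exact FatPoint.hasHilbertPolynomial_of_ncard_normalSet hp hmult hchar
      (fun k => binom (n + k - 2) n)
      fun k i hk hi => FatPoint.ncard_normalSet_of_degree_top hk hi
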